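/- **Setting.** Let $\Bbbk$ be a field of characteristic $0$ and use two colours: dotted (the Lie algebra) and straight (the module). $\mathrm{MLie}$ is the symmetric $2$-coloured $\Bbbk$-linear operad generated by a binary operation $\beta$ (dotted inputs and output) with $\beta(1,2)=-\beta(2,1)$ and a binary operation $d$ (first input dotted, second input and output straight), subject to $$\beta(\beta(1,2),3)-\beta(\beta(1,3),2)-\beta(1,\beta(2,3))=0,\qquad d(\beta(1,2),3)-d(1,d(2,3))+d(2,d(1,3))=0;$$ its algebras are pairs of a Lie algebra and a module over it. Let $\mathcal F$ be the free shuffle $2$-coloured operad on $\beta$, $d$ and $e$, where $e$ (first input and output straight, second input dotted) stands for $e(1,2)=d(2,1)$. The component $\mathcal F(n,\chi,c)$ has as basis the *tree monomials*: planar trees with vertices marked by $\beta,d,e$ such that the colours of edges match, the leaves are labelled bijectively by $1,\dots,n$ and coloured by $\chi$, the output has colour $c$, and at each vertex the smallest labels above the inputs increase from left to right. Let $\mathcal M\subset\mathcal F$ be the ideal of relations of $\mathrm{MLie}$ regarded as a shuffle operad, that is, the kernel of the canonical map $\mathcal F\to\mathrm{MLie}$ of shuffle operads. **Orderings.** An *admissible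 ordering* is a total ordering of the tree monomials in which a monomial of smaller arity is smaller, and in which $u\le u'$ (of the same arity) and $v\le v'$ (of the same arity) imply $u\circ_{i,\omega}v\le u'\circ_{i,\omega}v'$ for every shuffle composition for which both sides are defined. To each leaf of a tree monomial assign the product of the variables of the vertices on the path from the root to it, in the monoid of quantum monomials generated by $x,y,q$ with $q$ central and $yx=xyq$, where $d$ and $e$ give $x$ and $\beta$ gives $y$. Order quantum monomials by: $x^{a_1}y^{b_1}q^{c_1}<x^{a_2}y^{b_2}q^{c_2}$ if $a_1>a_2$, or $a_1=a_2$ and $b_1<b_2$, or $a_1=a_2$, $b_1=b_2$ and $c_1<c_2$. The *QM-ordering* is the partial ordering of tree monomials that compares first the arities and then, lexicographically, the vectors of quantum monomials of the leaves $1,\dots,n$. A set $G$ of elements of components of $\mathcal F$ is a *Gröbner basis* of $\mathcal M$ for an admissible ordering if it generates $\mathcal M$ as an operadic ideal and the leading term of every non-zero element of every component of $\mathcal M$ is divisible by the leading term of some element of $G$. (A tree monomial $u$ is divisible by $v$ if $v$ is obtained from a subtree of $u$ by relabelling its leaves in the order of the smallest labels of $u$ above them.) It is *quadratic* if all its elements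 are combinations of tree monomials with exactly two vertices. **Theorem.** The QM-ordering extends to an admissible ordering of the tree monomials of $\mathcal F$, and there is a quadratic set $G$ that is a Gröbner basis of $\mathcal M$ with respect to every admissible ordering extending the QM-ordering. In particular, the operad $\mathrm{MLie}$ admits a quadratic Gröbner basis with respect to the QM-ordering in which $d$ and $e$ play the role of $x$ and $\beta$ plays the role of $y$. -/

import Mathlib

noncomputable section

namespace ColouredOperad

/-! ### Planar binary trees -/

/-- Planar rooted binary trees whose vertices are marked by elements of `Υ` and whose leaves are
labelled by elements of `L`. A single leaf is the degenerate tree. -/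
inductive PTree (Υ L : Type) : Type
  | leaf (l : L) : PTree Υ L
  | node (a : Υ) (s t : PTree Υ L) : PTree Υ L

namespace PTree

variable {Υ Υ' L M : Type}

/-- The labels of the leaves, from left to right. -/
def leaves : PTree Υ L → List L
  | leaf l => [l]
  | node _ s t => s.leaves ++ t.leaves

/-- The operation degree: the number of inner vertices. -/
def vertices : PTree Υ L → ℕ
  | leaf _ => 0
  | node _ s t => s.vertices + t.vertices + 1

/-- Graft the tree `φ l` on the leaf labelled `l`, for all labels `l`. -/
def bind : PTree Υ L → (L → PTree Υ M) → PTree Υ M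
  | leaf l, φ => φ l
  | node a s t, φ => node a (s.bind φ) (t.bind φ)

/-- Relabel the leaves. -/
def relabel (f : L → M) (t : PTree Υ L) : PTree Υ M := t.bind fun l => leaf (f l)

/-- The smallest label of a leaf. -/
def minLabel [LinearOrder L] : PTree Υ L → L
  | leaf l => l
  | node _ s t => min s.minLabel t.minLabel

/-- The shuffle condition: at every vertex the smallest labels reachable through the inputs
increase from left to right. -/
def IsShuffle [LinearOrder L] : PTree Υ L → Prop
  | leaf _ => True
  | node _ s t => s.IsShuffle ∧ t.IsShuffle ∧ s.minLabel < t.minLabel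

/-- `s` is the part of the tree lying above some edge of the second argument (the root edge,
an inner edge or a leaf). -/
inductive IsBranch (s : PTree Υ L) : PTree Υ L → Prop
  | refl : IsBranch s s
  | left (a : Υ) (t u : PTree Υ L) : IsBranch s t → IsBranch s (node a t u)
  | right (a : Υ) (t u : PTree Υ L) : IsBranch s u → IsBranch s (node a t u)

/-- The composition `s ∘_i t`: the tree `t`, with labels renamed by `g`, is grafted on the leaf
of `s` labelled `i`, and the other labels of `s` are renamed by `f`. -/
def graft {m n N : ℕ} (i : Fin m) (f : Fin m → Fin N) (g : Fin n → Fin N)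
    (s : PTree Υ (Fin m)) (t : PTree Υ (Fin n)) : PTree Υ (Fin N) :=
  s.bind fun j => if j = i then t.relabel g else leaf (f j)

end PTree

/-! ### Coloured trees and free coloured operads with binary generators -/

/-- A set `Υ` of binary generators with coloured output and inputs, the colours being taken
from `I`. -/
structure Signature (I Υ : Type) where
  out : Υ → I
  left : Υ → I
  right : Υ → I

variable {I Υ : Type}

/-- The colour of the root edge, when the leaf labelled `l` has the colour `χ l`. -/
def rootColour {L : Type} (S : Signature I Υ) (χ : L → I) : PTree Υ L → I
  | .leaf l => χ l
  | .node a _ _ => S.out a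

/-- At every vertex the colours of the incoming edges are those of the inputs of the generator. -/
def WellColoured {L : Type} (S : Signature I Υ) (χ : L → I) : PTree Υ L → Prop
  | .leaf _ => True
  | .node a s t => WellColoured S χ s ∧ WellColoured S χ t ∧
      rootColour S χ s = S.left a ∧ rootColour S χ t = S.right a

/-- `t` is a coloured planar tree with output colour `c`, whose leaves are labelled bijectively by
`Fin n` and coloured by `χ`. -/
def IsColouredTree {n : ℕ} (S : Signature I Υ) (χ : Fin n → I) (c : I)
    (t : PTree Υ (Fin n)) : Prop :=
  WellColoured S χ t ∧ rootColour S χ t = c ∧ t.leaves.Nodup ∧ ∀ l, l ∈ t.leaves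

/-- `t` is a coloured shuffle tree, i.e. a tree monomial of the component `(n, χ, c)` of the free
shuffle coloured operad. -/
def IsShuffleTree {n : ℕ} (S : Signature I Υ) (χ : Fin n → I) (c : I)
    (t : PTree Υ (Fin n)) : Prop :=
  IsColouredTree S χ c t ∧ t.IsShuffle

variable (k : Type*) [Field k]

/-- The component `(n, χ, c)` of the free symmetric coloured operad on the given generators, without
any symmetries imposed on the generators: its basis is the set of all coloured planar trees with
arbitrary bijective labellings. -/
def freeSym {n : ℕ} (S : Signature I Υ) (χ : Fin n → I) (c : I) :
    Submodule k (PTree Υ (Fin n) →₀ k) :=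
  Finsupp.supported k k {t | IsColouredTree S χ c t}

/-- The component `(n, χ, c)` of the free shuffle coloured operad on the given generators. -/
def freeShuffle {n : ℕ} (S : Signature I Υ) (χ : Fin n → I) (c : I) :
    Submodule k (PTree Υ (Fin n) →₀ k) :=
  Finsupp.supported k k {t | IsShuffleTree S χ c t}

variable {k}

/-- The bilinear extension of the composition of trees. -/
def comp {m n N : ℕ} (i : Fin m) (f : Fin m → Fin N) (g : Fin n → Fin N)
    (x : PTree Υ (Fin m) →₀ k) (y : PTree Υ (Fin n) →₀ k) : PTree Υ (Fin N) →₀ k :=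
  x.sum fun s a => y.sum fun t b => Finsupp.single (PTree.graft i f g s t) (a * b)

/-- The renamings `f` (away from `i`) and `g` identify the disjoint union of `Fin m \ {i}` and
`Fin n` with `Fin N`. The corresponding operations `comp i f g` are all the partial compositions
`∘_i` followed by arbitrary permutations of the labels. -/
def IsSymComposition {m n N : ℕ} (i : Fin m) (f : Fin m → Fin N) (g : Fin n → Fin N) : Prop :=
  Set.InjOn f {i}ᶜ ∧ Function.Injective g ∧ (∀ j, j ≠ i → ∀ l, f j ≠ g l) ∧
    ∀ p, (∃ j, j ≠ i ∧ f j = p) ∨ ∃ l, g l = p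

/-- The shuffle compositions `∘_{i,ω}`: both renamings preserve the order, where the input `i` of
the first tree counts as the smallest label of the second one. -/
def IsShuffleComposition {m n N : ℕ} (i : Fin m) (f : Fin m → Fin N) (g : Fin n → Fin N) : Prop :=
  IsSymComposition i f g ∧ StrictMono f ∧ StrictMono g ∧ IsLeast (Set.range g) (f i)

/-- `χ` is the colouring of the labels of the composite. -/
def IsCompositeColouring {m n N : ℕ} (i : Fin m) (f : Fin m → Fin N) (g : Fin n → Fin N)
    (χ₁ : Fin m → I) (χ₂ : Fin n → I) (χ : Fin N → I) : Prop :=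
  (∀ j, j ≠ i → χ (f j) = χ₁ j) ∧ ∀ l, χ (g l) = χ₂ l

/-- A family of sets of elements, one for each component `(n, χ, c)`. -/
abbrev Family (k : Type*) [Field k] (I Υ : Type) := ∀ n : ℕ, (Fin n → I) → I → Set (PTree Υ (Fin n) →₀ k)

/-- Membership in the operadic ideal of the free symmetric coloured operad generated by `R`.
(Composition with identities includes the action of the symmetric groups.) -/
inductive InSymIdeal (S : Signature I Υ) (R : Family k I Υ) :
    ∀ {n : ℕ}, (Fin n → I) → I → (PTree Υ (Fin n) →₀ k) → Prop
  | rel {n : ℕ} {χ : Fin n → I} {c : I} {x : PTree Υ (Fin n) →₀ k} :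
      x ∈ R n χ c → InSymIdeal S R χ c x
  | zero {n : ℕ} (χ : Fin n → I) (c : I) : InSymIdeal S R χ c 0
  | add {n : ℕ} {χ : Fin n → I} {c : I} {x y : PTree Υ (Fin n) →₀ k} :
      InSymIdeal S R χ c x → InSymIdeal S R χ c y → InSymIdeal S R χ c (x + y)
  | smul {n : ℕ} {χ : Fin n → I} {c : I} (a : k) {x : PTree Υ (Fin n) →₀ k} :
      InSymIdeal S R χ c x → InSymIdeal S R χ c (a • x)
  | comp_left {m n N : ℕ} {i : Fin m} {f : Fin m → Fin N} {g : Fin n → Fin N}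
      {χ₁ : Fin m → I} {χ₂ : Fin n → I} {χ : Fin N → I} {c : I}
      {x : PTree Υ (Fin m) →₀ k} {y : PTree Υ (Fin n) →₀ k} :
      IsSymComposition i f g → IsCompositeColouring i f g χ₁ χ₂ χ →
      InSymIdeal S R χ₁ c x → y ∈ freeSym k S χ₂ (χ₁ i) → InSymIdeal S R χ c (comp i f g x y)
  | comp_right {m n N : ℕ} {i : Fin m} {f : Fin m → Fin N} {g : Fin n → Fin N}
      {χ₁ : Fin m → I} {χ₂ : Fin n → I} {χ : Fin N → I} {c : I}
      {x : PTree Υ (Fin m) →₀ k} {y : PTree Υ (Fin n) →₀ k} :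
      IsSymComposition i f g → IsCompositeColouring i f g χ₁ χ₂ χ →
      x ∈ freeSym k S χ₁ c → InSymIdeal S R χ₂ (χ₁ i) y → InSymIdeal S R χ c (comp i f g x y)

/-- Membership in the operadic ideal of the free shuffle coloured operad generated by `R`. -/
inductive InShuffleIdeal (S : Signature I Υ) (R : Family k I Υ) :
    ∀ {n : ℕ}, (Fin n → I) → I → (PTree Υ (Fin n) →₀ k) → Prop
  | rel {n : ℕ} {χ : Fin n → I} {c : I} {x : PTree Υ (Fin n) →₀ k} :
      x ∈ R n χ c → InShuffleIdeal S R χ c x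
  | zero {n : ℕ} (χ : Fin n → I) (c : I) : InShuffleIdeal S R χ c 0
  | add {n : ℕ} {χ : Fin n → I} {c : I} {x y : PTree Υ (Fin n) →₀ k} :
      InShuffleIdeal S R χ c x → InShuffleIdeal S R χ c y → InShuffleIdeal S R χ c (x + y)
  | smul {n : ℕ} {χ : Fin n → I} {c : I} (a : k) {x : PTree Υ (Fin n) →₀ k} :
      InShuffleIdeal S R χ c x → InShuffleIdeal S R χ c (a • x)
  | comp_left {m n N : ℕ} {i : Fin m} {f : Fin m → Fin N} {g : Fin n → Fin N}
      {χ₁ : Fin m → I} {χ₂ : Fin n → I} {χ : Fin N → I} {c : I}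
      {x : PTree Υ (Fin m) →₀ k} {y : PTree Υ (Fin n) →₀ k} :
      IsShuffleComposition i f g → IsCompositeColouring i f g χ₁ χ₂ χ →
      InShuffleIdeal S R χ₁ c x → y ∈ freeShuffle k S χ₂ (χ₁ i) →
      InShuffleIdeal S R χ c (comp i f g x y)
  | comp_right {m n N : ℕ} {i : Fin m} {f : Fin m → Fin N} {g : Fin n → Fin N}
      {χ₁ : Fin m → I} {χ₂ : Fin n → I} {χ : Fin N → I} {c : I}
      {x : PTree Υ (Fin m) →₀ k} {y : PTree Υ (Fin n) →₀ k} :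
      IsShuffleComposition i f g → IsCompositeColouring i f g χ₁ χ₂ χ →
      x ∈ freeShuffle k S χ₁ c → InShuffleIdeal S R χ₂ (χ₁ i) y →
      InShuffleIdeal S R χ c (comp i f g x y)

/-! ### Admissible orderings, leading terms, divisibility, Gröbner bases -/

/-- The tree monomials of the free shuffle coloured operad, of all arities and colours. -/
structure TreeMonomial (S : Signature I Υ) where
  arity : ℕ
  colouring : Fin arity → I
  colour : I
  tree : PTree Υ (Fin arity)
  isShuffleTree : IsShuffleTree S colouring colour tree

/-- `r` is (the non-strict relation of) an admissible ordering of the tree monomials. -/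
structure IsAdmissible (S : Signature I Υ) (r : TreeMonomial S → TreeMonomial S → Prop) :
    Prop where
  refl : ∀ α, r α α
  trans : ∀ α β γ, r α β → r β γ → r α γ
  antisymm : ∀ α β, r α β → r β α → α = β
  total : ∀ α β, r α β ∨ r β α
  arity : ∀ α β : TreeMonomial S, α.arity < β.arity → r α β
  comp : ∀ {m n N : ℕ} (i : Fin m) (f : Fin m → Fin N) (g : Fin n → Fin N)
    (χ₁ χ₁' : Fin m → I) (χ₂ χ₂' : Fin n → I) (χ χ' : Fin N → I) (c c' : I)
    (s s' : PTree Υ (Fin m)) (t t' : PTree Υ (Fin n))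
    (hs : IsShuffleTree S χ₁ c s) (hs' : IsShuffleTree S χ₁' c' s')
    (ht : IsShuffleTree S χ₂ (χ₁ i) t) (ht' : IsShuffleTree S χ₂' (χ₁' i) t')
    (h : IsShuffleTree S χ c (PTree.graft i f g s t))
    (h' : IsShuffleTree S χ' c' (PTree.graft i f g s' t')),
    IsShuffleComposition i f g →
    IsCompositeColouring i f g χ₁ χ₂ χ → IsCompositeColouring i f g χ₁' χ₂' χ' →
    r ⟨m, χ₁, c, s, hs⟩ ⟨m, χ₁', c', s', hs'⟩ →
    r ⟨n, χ₂, χ₁ i, t, ht⟩ ⟨n, χ₂', χ₁' i, t', ht'⟩ →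
    r ⟨N, χ, c, PTree.graft i f g s t, h⟩ ⟨N, χ', c', PTree.graft i f g s' t', h'⟩

/-- `t` is the leading term of the element `x` of the component `(n, χ, c)`. -/
def IsLeadingTerm (S : Signature I Υ) (r : TreeMonomial S → TreeMonomial S → Prop) {n : ℕ}
    (χ : Fin n → I) (c : I) (x : PTree Υ (Fin n) →₀ k) (t : PTree Υ (Fin n)) : Prop :=
  t ∈ x.support ∧ ∃ ht : IsShuffleTree S χ c t,
    ∀ s ∈ x.support, ∃ hs : IsShuffleTree S χ c s, r ⟨n, χ, c, s, hs⟩ ⟨n, χ, c, t, ht⟩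

/-- The tree monomial `t` (with leaves coloured by `χ`) is divisible by the tree monomial `u` (with
leaves coloured by `χ'` and output colour `c'`): the tree `t` has a subtree which becomes `u` when
each of its leaves is labelled according to the smallest label of `t` reachable through it. Here
`φ l` is the part of `t` that grows from the leaf `l` of the subtree. -/
def IsDivisibleBy (S : Signature I Υ) {n n' : ℕ} (χ : Fin n → I) (t : PTree Υ (Fin n))
    (χ' : Fin n' → I) (c' : I) (u : PTree Υ (Fin n')) : Prop :=
  ∃ φ : Fin n' → PTree Υ (Fin n), (u.bind φ).IsBranch t ∧ StrictMono (fun l => (φ l).minLabel) ∧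
    (∀ l, rootColour S χ (φ l) = χ' l) ∧ rootColour S χ (u.bind φ) = c'

/-- `G` is a Gröbner basis of the ideal `M` with respect to the ordering `r`: it generates `M` as an
ideal, and the leading term of every (non-zero) element of `M` is divisible by the leading term of
some element of `G`. -/
structure IsGroebnerBasis (S : Signature I Υ) (r : TreeMonomial S → TreeMonomial S → Prop)
    (G M : Family k I Υ) : Prop where
  generates : ∀ (n : ℕ) (χ : Fin n → I) (c : I) (x : PTree Υ (Fin n) →₀ k),
    x ∈ M n χ c ↔ InShuffleIdeal S G χ c x
  divisible : ∀ (n : ℕ) (χ : Fin n → I) (c : I), ∀ x ∈ M n χ c, ∀ t : PTree Υ (Fin n),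
    IsLeadingTerm S r χ c x t →
    ∃ (n' : ℕ) (χ' : Fin n' → I) (c' : I), ∃ y ∈ G n' χ' c', ∃ u : PTree Υ (Fin n'),
      IsLeadingTerm S r χ' c' y u ∧ IsDivisibleBy S χ t χ' c' u

/-- All elements of `G` are combinations of tree monomials with exactly two vertices. -/
def IsQuadratic (G : Family k I Υ) : Prop :=
  ∀ (n : ℕ) (χ : Fin n → I) (c : I), ∀ x ∈ G n χ c, ∀ t ∈ x.support, PTree.vertices t = 2

/-! ### The QM-ordering -/

/-- The quantum monomial `x ^ a * y ^ b * q ^ c`. -/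
@[ext]
structure QMonomial where
  a : ℕ
  b : ℕ
  c : ℕ

namespace QMonomial

/-- Multiplication subject to `y * x = x * y * q` with `q` central. -/
instance : Mul QMonomial := ⟨fun u v => ⟨u.a + v.a, u.b + v.b, u.c + v.c + u.b * v.a⟩⟩

instance : One QMonomial := ⟨⟨0, 0, 0⟩⟩

/-- The variable `x`. -/
def x : QMonomial := ⟨1, 0, 0⟩

/-- The variable `y`. -/
def y : QMonomial := ⟨0, 1, 0⟩

instance : LT QMonomial :=
  ⟨fun u v => v.a < u.a ∨ (u.a = v.a ∧ u.b < v.b) ∨ (u.a = v.a ∧ u.b = v.b ∧ u.c < v.c)⟩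

end QMonomial

/-- The product of the weights of the vertices on the path from the root to the leaf labelled `l`. -/
def pathMonomial {L : Type} [DecidableEq L] (w : Υ → QMonomial) (l : L) : PTree Υ L → QMonomial
  | .leaf _ => 1
  | .node a s t => w a * if l ∈ s.leaves then pathMonomial w l s else pathMonomial w l t

/-- The vector of quantum monomials corresponding to the paths from the root to the leaves. -/
def pathVector {S : Signature I Υ} (w : Υ → QMonomial) (α : TreeMonomial S) : List QMonomial :=
  List.ofFn fun l => pathMonomial w l α.tree

/-- The strict (partial) QM-ordering defined by assigning quantum monomials to the generators:
compare the arities, then the path vectors lexicographically. -/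
def QMLt {S : Signature I Υ} (w : Υ → QMonomial) (α β : TreeMonomial S) : Prop :=
  α.arity < β.arity ∨
    (α.arity = β.arity ∧ List.Lex (· < ·) (pathVector w α) (pathVector w β))

/-- `r` extends the QM-ordering. -/
def ExtendsQM {S : Signature I Υ} (w : Υ → QMonomial)
    (r : TreeMonomial S → TreeMonomial S → Prop) : Prop :=
  ∀ α β, QMLt w α β → r α β

/-! ### The operad of a Lie algebra with a module -/

/-- The colour `lie` (drawn dotted) is that of the Lie algebra, the colour `mod` (drawn straight) is
that of the module. -/
inductive Colour
  | lie
  | mod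

/-- Generators of the symmetric operad: the Lie bracket `β` and the action `d`. -/
inductive SymGen
  | β
  | d

/-- Generators of the corresponding shuffle operad: `β`, `d` and the opposite `e` of `d`. -/
inductive ShGen
  | β
  | d
  | e

open Colour PTree

/-- The colours of the symmetric generators. -/
def symSignature : Signature Colour SymGen where
  out | .β => lie | .d => mod
  left | .β => lie | .d => lie
  right | .β => lie | .d => mod

/-- The colours of the shuffle generators. -/
def shSignature : Signature Colour ShGen where
  out | .β => lie | .d => mod | .e => mod
  left | .β => lie | .d => lie | .e => mod
  right | .β => lie | .d => mod | .e => lie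

/-- The defining relations of the symmetric coloured operad: the antisymmetry of `β`, the Jacobi
identity, and the compatibility of the action with the bracket. -/
inductive MLieRelation (k : Type*) [Field k] :
    ∀ n : ℕ, (Fin n → Colour) → Colour → (PTree SymGen (Fin n) →₀ k) → Prop
  | antisymm : MLieRelation k 2 ![lie, lie] lie
      (.single (node .β (leaf 0) (leaf 1)) 1 + .single (node .β (leaf 1) (leaf 0)) 1)
  | jacobi : MLieRelation k 3 ![lie, lie, lie] lie
      (.single (node .β (node .β (leaf 0) (leaf 1)) (leaf 2)) 1
        - .single (node .β (node .β (leaf 0) (leaf 2)) (leaf 1)) 1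
        - .single (node .β (leaf 0) (node .β (leaf 1) (leaf 2))) 1)
  | action : MLieRelation k 3 ![lie, lie, mod] mod
      (.single (node .d (node .β (leaf 0) (leaf 1)) (leaf 2)) 1
        - .single (node .d (leaf 0) (node .d (leaf 1) (leaf 2))) 1
        + .single (node .d (leaf 1) (node .d (leaf 0) (leaf 2))) 1)

/-- The operation of the free symmetric operad represented by a shuffle tree:
`e(s, t)` stands for `d(t, s)`. -/
def toSym {L : Type} : PTree ShGen L → PTree SymGen L
  | .leaf l => leaf l
  | .node .β s t => node .β (toSym s) (toSym t)
  | .node .d s t => node .d (toSym s) (toSym t)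
  | .node .e s t => node .d (toSym t) (toSym s)

/-- The ideal of relations between the generators `β`, `d`, `e` in the shuffle operad obtained from
the symmetric operad MLie by the forgetful functor, i.e. the kernel of the canonical map from the
free shuffle operad on `β`, `d`, `e` to MLie. -/
def MLieIdeal (k : Type*) [Field k] : Family k Colour ShGen := fun _ χ c =>
  {x | x ∈ freeShuffle k shSignature χ c ∧
    InSymIdeal symSignature (fun n χ c => {y | MLieRelation k n χ c y}) χ c (x.mapDomain toSym)}

/-- `d` and `e` are `x`-type variables, `β` is a `y`-type variable. -/
def mlieWeight : ShGen → QMonomial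
  | .β => .y
  | .d => .x
  | .e => .x

end ColouredOperad

end

noncomputable section

namespace ColouredOperad

open Colour PTree

/-! ### Trees -/

namespace PTree

variable {Υ Υ' L M N : Type}

/-! The Gröbner basis consists of four relators: the Jacobi identity, and the compatibility of the
action with the bracket for each of the three positions of the module input. Their leading trees are
β(β(1,2),3), d(β(1,2),3), d(β(1,3),2) and e(1,β(2,3)). The vectors of path monomials alone single
them out, so they are the same for every admissible extension of the QM-ordering. A tree is normal
if none of them divides it: the Lie input of every `d` and `e` is a leaf, and in every β(β(u,v),t)
the smallest label of t is below that of v.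

Instead of resolving critical pairs, the proof shows that the normal trees form a basis of the
quotient. They span: modulo the relators a non-normal tree is a combination of QM-smaller trees
(`reducible_of_not_isNormal`), and a component contains only finitely many trees, so the reduction
stops (`exists_normal_form`). They are independent (`eq_zero_of_isNormal`): every associative
algebra is a Lie algebra under the commutator and a module over it by left multiplication, so
relations of MLie evaluate to zero in it (`linearCombination_evalTree_eq_zero`). In the free
associative algebra on the labels, the least word in the value of a shuffle tree t is the list of
leaves of `toSym t`, with coefficient 1 (`hasLeastWord_evalTree`), and a normal tree can be
recovered from that word (`eq_of_leaves_toSym_eq`). The evaluation is therefore triangular on normal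
trees.

Hence every element of the ideal of relations has normal form zero. This says that the relators
generate the ideal. It also forbids a normal leading term: such a term would be QM-maximal in the
element and would keep its coefficient in the normal form. A non-normal tree contains one of the
four leading trees, which is the required divisibility.

For the existence of an admissible extension, path monomials multiply under grafting, and so do the
words that record the generators and directions along the paths. Both lie in totally ordered monoids
with strictly monotone multiplication. Comparing arity, path monomials, words and output colour in
turn is thus compatible with composition, and it is total because the words determine the tree. -/

theorem leaves_bind (t : PTree Υ L) (φ : L → PTree Υ M) :
    (t.bind φ).leaves = t.leaves.flatMap fun l => (φ l).leaves := by
  induction t with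
  | leaf l => simp [bind, leaves]
  | node a s t hs ht => simp [bind, leaves, hs, ht]

theorem leaves_relabel (f : L → M) (t : PTree Υ L) : (t.relabel f).leaves = t.leaves.map f := by
  rw [relabel, leaves_bind]
  simp [leaves]
  exact List.flatMap_pure_eq_map f t.leaves

theorem bind_bind (t : PTree Υ L) (φ : L → PTree Υ M) (ψ : M → PTree Υ N) :
    (t.bind φ).bind ψ = t.bind fun l => (φ l).bind ψ := by
  induction t with
  | leaf l => rfl
  | node a s t hs ht => simp [bind, hs, ht]

theorem bind_congr (t : PTree Υ L) {φ ψ : L → PTree Υ M} (h : ∀ l ∈ t.leaves, φ l = ψ l) :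
    t.bind φ = t.bind ψ := by
  induction t with
  | leaf l => exact h l (by simp [leaves])
  | node a s t hs ht =>
    simp only [leaves, List.mem_append] at h
    simp only [bind, hs fun l hl => h l (Or.inl hl), ht fun l hl => h l (Or.inr hl)]

theorem bind_leaf (t : PTree Υ L) : t.bind leaf = t := by
  induction t with
  | leaf l => rfl
  | node a s t hs ht => simp [bind, hs, ht]

theorem relabel_relabel (f : L → M) (g : M → N) (t : PTree Υ L) :
    (t.relabel f).relabel g = t.relabel (g ∘ f) := by
  rw [relabel, relabel, bind_bind]; rfl

theorem relabel_eq_self (t : PTree Υ L) {f : L → L} (h : ∀ l ∈ t.leaves, f l = l) :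
    t.relabel f = t := by
  rw [relabel, bind_congr t (ψ := leaf) fun l hl => by rw [h l hl], bind_leaf]

theorem leaves_ne_nil (t : PTree Υ L) : t.leaves ≠ [] := by
  induction t with
  | leaf l => simp [leaves]
  | node a s t hs ht => simp [leaves, hs]

theorem length_leaves (t : PTree Υ L) : t.leaves.length = t.vertices + 1 := by
  induction t with
  | leaf l => rfl
  | node a s t hs ht => simp only [leaves, List.length_append, hs, ht, vertices]; omega

section LinearOrder

variable [LinearOrder L] [LinearOrder M]

theorem minLabel_mem (t : PTree Υ L) : t.minLabel ∈ t.leaves := by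
  induction t with
  | leaf l => simp [leaves, minLabel]
  | node a s t hs ht =>
    rcases min_choice s.minLabel t.minLabel with h | h <;> simp [leaves, minLabel, h, hs, ht]

theorem minLabel_le (t : PTree Υ L) {l : L} (hl : l ∈ t.leaves) : t.minLabel ≤ l := by
  induction t with
  | leaf l' => simp_all [leaves, minLabel]
  | node a s t hs ht =>
    simp only [leaves, List.mem_append] at hl
    rcases hl with h | h
    · exact min_le_of_left_le (hs h)
    · exact min_le_of_right_le (ht h)

theorem minLabel_eq (t : PTree Υ L) {l : L} (hl : l ∈ t.leaves) (h : ∀ l' ∈ t.leaves, l ≤ l') :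
    t.minLabel = l :=
  le_antisymm (t.minLabel_le hl) (h _ t.minLabel_mem)

/-- Monotonicity is needed on the leaves of `t` only: the smallest label then sits in the tree
grafted on the smallest leaf. -/
theorem minLabel_bind (t : PTree Υ L) (φ : L → PTree Υ M)
    (h : MonotoneOn (fun l => (φ l).minLabel) {l | l ∈ t.leaves}) :
    (t.bind φ).minLabel = (φ t.minLabel).minLabel := by
  refine minLabel_eq _ ?_ fun l' hl' => ?_
  · rw [leaves_bind, List.mem_flatMap]
    exact ⟨_, t.minLabel_mem, minLabel_mem _⟩
  · rw [leaves_bind, List.mem_flatMap] at hl'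
    obtain ⟨l, hl, hl'⟩ := hl'
    exact (h t.minLabel_mem hl (t.minLabel_le hl)).trans (minLabel_le _ hl')

/-- By `minLabel_bind`, strict monotonicity turns the comparison at each vertex of `t` into the
comparison at the same vertex after grafting. -/
theorem isShuffle_bind (t : PTree Υ L) (φ : L → PTree Υ M)
    (h : StrictMonoOn (fun l => (φ l).minLabel) {l | l ∈ t.leaves}) :
    (t.bind φ).IsShuffle ↔ t.IsShuffle ∧ ∀ l ∈ t.leaves, (φ l).IsShuffle := by
  induction t with
  | leaf l => simp [bind, IsShuffle, leaves]
  | node a s t hs ht =>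
    have h1 : StrictMonoOn (fun l => (φ l).minLabel) {l | l ∈ s.leaves} :=
      h.mono fun l hl => by simp_all [leaves]
    have h2 : StrictMonoOn (fun l => (φ l).minLabel) {l | l ∈ t.leaves} :=
      h.mono fun l hl => by simp_all [leaves]
    have h3 := h.lt_iff_lt (a := s.minLabel) (b := t.minLabel)
      (by simp [leaves, minLabel_mem]) (by simp [leaves, minLabel_mem])
    simp only [bind, IsShuffle, hs h1, ht h2, minLabel_bind s φ h1.monotoneOn,
      minLabel_bind t φ h2.monotoneOn, h3, leaves, List.mem_append]
    constructor
    · rintro ⟨⟨a1, a2⟩, ⟨b1, b2⟩, c⟩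
      exact ⟨⟨a1, b1, c⟩, fun l hl => hl.elim (a2 l) (b2 l)⟩
    · rintro ⟨⟨a1, b1, c⟩, d⟩
      exact ⟨⟨a1, fun l hl => d l (Or.inl hl)⟩, ⟨b1, fun l hl => d l (Or.inr hl)⟩, c⟩

theorem minLabel_relabel (t : PTree Υ L) {f : L → M} (hf : StrictMono f) :
    (t.relabel f).minLabel = f t.minLabel :=
  minLabel_bind t (fun l => leaf (f l)) (fun _ _ _ _ h => hf.monotone h)

theorem isShuffle_relabel (t : PTree Υ L) {f : L → M} (hf : StrictMono f) :
    (t.relabel f).IsShuffle ↔ t.IsShuffle := by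
  rw [relabel, isShuffle_bind _ _ fun _ _ _ _ h => hf h]
  simp [IsShuffle]

end LinearOrder

theorem nodup_leaves_bind (t : PTree Υ L) (φ : L → PTree Υ M) (ht : t.leaves.Nodup)
    (hφ : ∀ l ∈ t.leaves, (φ l).leaves.Nodup)
    (hd : ∀ l ∈ t.leaves, ∀ l' ∈ t.leaves, l ≠ l' → (φ l).leaves.Disjoint (φ l').leaves) :
    (t.bind φ).leaves.Nodup := by
  rw [leaves_bind, List.nodup_flatMap]
  refine ⟨hφ, ?_⟩
  exact ht.imp_of_mem fun {a b} ha hb hab => hd a ha b hb hab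

end PTree

/-! ### Coloured shuffle trees on finite sets of labels. -/

section Coloured

variable {I Υ L M : Type} {S : Signature I Υ}

theorem rootColour_bind {χ : M → I} {χ' : L → I} (t : PTree Υ L) (φ : L → PTree Υ M)
    (h : ∀ l ∈ t.leaves, rootColour S χ (φ l) = χ' l) :
    rootColour S χ (t.bind φ) = rootColour S χ' t := by
  cases t with
  | leaf l => exact h l (by simp [leaves])
  | node a s t => rfl

theorem wellColoured_bind {χ : M → I} {χ' : L → I} (t : PTree Υ L) (φ : L → PTree Υ M)
    (h : ∀ l ∈ t.leaves, rootColour S χ (φ l) = χ' l) :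
    WellColoured S χ (t.bind φ) ↔
      WellColoured S χ' t ∧ ∀ l ∈ t.leaves, WellColoured S χ (φ l) := by
  induction t with
  | leaf l => simp [PTree.bind, WellColoured, leaves]
  | node a s t hs ht =>
    simp only [leaves, List.mem_append] at h
    have h1 := fun l hl => h l (Or.inl hl)
    have h2 := fun l hl => h l (Or.inr hl)
    simp only [PTree.bind, WellColoured, hs h1, ht h2, rootColour_bind s φ h1,
      rootColour_bind t φ h2, leaves, List.mem_append]
    constructor
    · rintro ⟨⟨a1, a2⟩, ⟨b1, b2⟩, c⟩
      exact ⟨⟨a1, b1, c⟩, fun l hl => hl.elim (a2 l) (b2 l)⟩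
    · rintro ⟨⟨a1, b1, c⟩, d⟩
      exact ⟨⟨a1, fun l hl => d l (Or.inl hl)⟩, ⟨b1, fun l hl => d l (Or.inr hl)⟩, c⟩

theorem rootColour_relabel (χ : M → I) (f : L → M) (t : PTree Υ L) :
    rootColour S χ (t.relabel f) = rootColour S (χ ∘ f) t :=
  rootColour_bind t _ fun _ _ => rfl

theorem wellColoured_relabel (χ : M → I) (f : L → M) (t : PTree Υ L) :
    WellColoured S χ (t.relabel f) ↔ WellColoured S (χ ∘ f) t := by
  rw [PTree.relabel, wellColoured_bind (χ' := χ ∘ f) t _ fun _ _ => rfl]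
  simp [WellColoured]

/-- `t` is a coloured shuffle tree with output colour `c` whose leaves are labelled bijectively by
the elements of `A`, a finite set of labels coloured by `χ`. -/
structure IsShuffleTreeOn [LinearOrder L] (S : Signature I Υ) (χ : L → I) (c : I) (A : Finset L)
    (t : PTree Υ L) : Prop where
  wellColoured : WellColoured S χ t
  rootColour : rootColour S χ t = c
  nodup : t.leaves.Nodup
  mem_leaves : ∀ l, l ∈ t.leaves ↔ l ∈ A
  isShuffle : t.IsShuffle

theorem isShuffleTree_iff {n : ℕ} {χ : Fin n → I} {c : I} {t : PTree Υ (Fin n)} :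
    IsShuffleTree S χ c t ↔ IsShuffleTreeOn S χ c Finset.univ t :=
  ⟨fun ⟨⟨h1, h2, h3, h4⟩, h5⟩ => ⟨h1, h2, h3, by simpa using h4, h5⟩,
    fun ⟨h1, h2, h3, h4, h5⟩ => ⟨⟨h1, h2, h3, by simpa using h4⟩, h5⟩⟩

variable [LinearOrder L] [LinearOrder M]

theorem IsShuffleTreeOn.minLabel_mem {χ : L → I} {c : I} {A : Finset L} {t : PTree Υ L}
    (h : IsShuffleTreeOn S χ c A t) : t.minLabel ∈ A :=
  (h.mem_leaves _).1 t.minLabel_mem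

theorem IsShuffleTreeOn.bind {χ' : L → I} {χ : M → I} {c : I} {A : Finset L} {B : L → Finset M}
    {C : Finset M} {t : PTree Υ L} {φ : L → PTree Υ M} (ht : IsShuffleTreeOn S χ' c A t)
    (hφ : ∀ l ∈ A, IsShuffleTreeOn S χ (χ' l) (B l) (φ l))
    (hm : StrictMonoOn (fun l => (φ l).minLabel) A)
    (hd : ∀ l ∈ A, ∀ l' ∈ A, l ≠ l' → Disjoint (B l) (B l'))
    (hC : ∀ x, x ∈ C ↔ ∃ l ∈ A, x ∈ B l) : IsShuffleTreeOn S χ c C (t.bind φ) := by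
  have hA : ∀ l, l ∈ t.leaves ↔ l ∈ A := ht.mem_leaves
  have hr : ∀ l ∈ t.leaves, ColouredOperad.rootColour S χ (φ l) = χ' l :=
    fun l hl => (hφ l ((hA l).1 hl)).rootColour
  refine ⟨?_, ?_, ?_, ?_, ?_⟩
  · exact (wellColoured_bind t φ hr).2
      ⟨ht.wellColoured, fun l hl => (hφ l ((hA l).1 hl)).wellColoured⟩
  · rw [rootColour_bind t φ hr, ht.rootColour]
  · refine nodup_leaves_bind t φ ht.nodup (fun l hl => (hφ l ((hA l).1 hl)).nodup) ?_
    intro l hl l' hl' hne x hx hx'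
    rw [hA] at hl hl'
    rw [(hφ l hl).mem_leaves] at hx
    rw [(hφ l' hl').mem_leaves] at hx'
    exact Finset.disjoint_left.1 (hd l hl l' hl' hne) hx hx'
  · intro x
    rw [leaves_bind, List.mem_flatMap, hC]
    refine exists_congr fun l => ?_
    rw [hA]
    exact and_congr_right fun hl => (hφ l hl).mem_leaves x
  · refine (isShuffle_bind t φ ?_).2 ⟨ht.isShuffle, fun l hl => (hφ l ((hA l).1 hl)).isShuffle⟩
    simpa [hA] using hm

theorem IsShuffleTreeOn.node {χ : L → I} {a : Υ} {A B C : Finset L} {s t : PTree Υ L}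
    (hs : IsShuffleTreeOn S χ (S.left a) A s) (ht : IsShuffleTreeOn S χ (S.right a) B t)
    (hm : s.minLabel < t.minLabel) (hd : Disjoint A B) (hC : ∀ x, x ∈ C ↔ x ∈ A ∨ x ∈ B) :
    IsShuffleTreeOn S χ (S.out a) C (.node a s t) := by
  refine ⟨⟨hs.wellColoured, ht.wellColoured, hs.rootColour, ht.rootColour⟩, rfl, ?_, ?_,
    hs.isShuffle, ht.isShuffle, hm⟩
  · rw [leaves, List.nodup_append']
    refine ⟨hs.nodup, ht.nodup, fun x hx hx' => ?_⟩
    rw [hs.mem_leaves] at hx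
    rw [ht.mem_leaves] at hx'
    exact Finset.disjoint_left.1 hd hx hx'
  · intro x
    rw [leaves, List.mem_append, hs.mem_leaves, ht.mem_leaves, hC]

theorem isShuffleTreeOn_leaf (χ : L → I) (l : L) :
    IsShuffleTreeOn S χ (χ l) {l} (leaf l : PTree Υ L) :=
  ⟨trivial, rfl, by simp [leaves], by simp [leaves], trivial⟩

/-- The two branches of a coloured shuffle tree at the root. -/
theorem IsShuffleTreeOn.of_node {χ : L → I} {c : I} {a : Υ} {A : Finset L} {s t : PTree Υ L}
    (h : IsShuffleTreeOn S χ c A (.node a s t)) :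
    IsShuffleTreeOn S χ (S.left a) s.leaves.toFinset s ∧
      IsShuffleTreeOn S χ (S.right a) t.leaves.toFinset t ∧ s.minLabel < t.minLabel ∧
      Disjoint s.leaves.toFinset t.leaves.toFinset ∧ S.out a = c ∧
      ∀ x, x ∈ A ↔ x ∈ s.leaves.toFinset ∨ x ∈ t.leaves.toFinset := by
  obtain ⟨⟨h1, h2, h3, h4⟩, h5, h6, h7, h8, h9, h10⟩ := h
  rw [leaves, List.nodup_append'] at h6
  refine ⟨⟨h1, h3, h6.1, by simp, h8⟩, ⟨h2, h4, h6.2.1, by simp, h9⟩, h10, ?_, h5, ?_⟩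
  · rw [Finset.disjoint_left]
    intro x hx hx'
    exact h6.2.2 (by simpa using hx) (by simpa using hx')
  · intro x
    rw [← h7]
    simp [leaves]

theorem isShuffleTreeOn_relabel {χ : M → I} {c : I} {A : Finset L} {B : Finset M} {f : L → M}
    (hf : StrictMono f) (hB : ∀ x, x ∈ B ↔ ∃ l ∈ A, f l = x) {t : PTree Υ L} :
    IsShuffleTreeOn S χ c B (t.relabel f) ↔ IsShuffleTreeOn S (χ ∘ f) c A t := by
  have h0 : (∀ x, x ∈ (t.relabel f).leaves ↔ x ∈ B) ↔ ∀ l, l ∈ t.leaves ↔ l ∈ A := by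
    simp only [leaves_relabel, List.mem_map, hB]
    constructor
    · intro h l
      have := h (f l)
      simpa [hf.injective.eq_iff] using this
    · intro h x
      simp [h]
  constructor
  · rintro ⟨h1, h2, h3, h4, h5⟩
    exact ⟨(wellColoured_relabel _ _ _).1 h1, by rw [← h2, rootColour_relabel],
      by rw [leaves_relabel] at h3; exact h3.of_map, h0.1 h4, (isShuffle_relabel _ hf).1 h5⟩
  · rintro ⟨h1, h2, h3, h4, h5⟩
    exact ⟨(wellColoured_relabel _ _ _).2 h1, by rw [← h2, rootColour_relabel],
      by rw [leaves_relabel]; exact h3.map hf.injective, h0.2 h4, (isShuffle_relabel _ hf).2 h5⟩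

/-- A shuffle composition of coloured shuffle trees is a coloured shuffle tree. -/
theorem isShuffleTree_graft {m n N : ℕ} {i : Fin m} {f : Fin m → Fin N} {g : Fin n → Fin N}
    {χ₁ : Fin m → I} {χ₂ : Fin n → I} {χ : Fin N → I} {c : I}
    (h : IsShuffleComposition i f g) (hχ : IsCompositeColouring i f g χ₁ χ₂ χ)
    {s : PTree Υ (Fin m)} {t : PTree Υ (Fin n)} (hs : IsShuffleTree S χ₁ c s)
    (ht : IsShuffleTree S χ₂ (χ₁ i) t) : IsShuffleTree S χ c (PTree.graft i f g s t) := by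
  obtain ⟨⟨-, -, hfg, hsurj⟩, hf, hg, hl⟩ := h
  rw [isShuffleTree_iff] at *
  -- In a shuffle composition the grafted tree has smallest label `f i`, so the smallest labels of
  -- all the trees put on the leaves of `s` are given by the increasing map `f` itself.
  have hmin : (t.relabel g).minLabel = f i := by
    rw [minLabel_relabel _ hg]
    obtain ⟨l, hl'⟩ := hl.1
    refine le_antisymm (hl' ▸ hg.monotone (t.minLabel_le ?_)) (hl.2 ⟨_, rfl⟩)
    exact (ht.mem_leaves l).2 (Finset.mem_univ _)
  have hgr : ∀ x, x ∈ Finset.univ.image g ↔ ∃ l ∈ (Finset.univ : Finset (Fin n)), g l = x := by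
    simp
  refine hs.bind (B := fun j => if j = i then Finset.univ.image g else {f j}) ?_ ?_ ?_ ?_
  · intro j _
    by_cases hj : j = i
    · subst hj
      simp only [if_true]
      refine (isShuffleTreeOn_relabel hg hgr).2 ?_
      rwa [show χ ∘ g = χ₂ from funext hχ.2]
    · simp only [if_neg hj]
      rw [← hχ.1 j hj]
      exact isShuffleTreeOn_leaf χ (f j)
  · have : (fun j => (if j = i then t.relabel g else leaf (f j)).minLabel) = f := by
      funext j
      by_cases hj : j = i
      · subst hj; simp [hmin]
      · simp [hj, minLabel]
    rw [this]
    exact hf.strictMonoOn _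
  · intro j _ j' _ hne
    by_cases hj : j = i <;> by_cases hj' : j' = i
    · exact absurd (hj.trans hj'.symm) hne
    · simp only [if_pos hj, if_neg hj', Finset.disjoint_singleton_right, Finset.mem_image,
        Finset.mem_univ, true_and, not_exists]
      exact fun l e => hfg j' hj' l e.symm
    · simp only [if_pos hj', if_neg hj, Finset.disjoint_singleton_left, Finset.mem_image,
        Finset.mem_univ, true_and, not_exists]
      exact fun l e => hfg j hj l e.symm
    · simp only [if_neg hj, if_neg hj', Finset.disjoint_singleton]
      exact fun e => hne (hf.injective e)
  · intro x
    simp only [Finset.mem_univ, true_and, true_iff]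
    rcases hsurj x with ⟨j, hj, rfl⟩ | ⟨l, rfl⟩
    · exact ⟨j, by simp [hj]⟩
    · exact ⟨i, by simp⟩

end Coloured

/-! ### Monomials of paths -/

section Paths

variable {Υ L M W : Type} [Monoid W]

/-- The product, along the path from the root to the leaf labelled `l`, of the weights `w a b` of
the vertices `a`, where `b` tells whether the path proceeds through the left input. -/
def pathProd [DecidableEq L] (w : Υ → Bool → W) (l : L) : PTree Υ L → W
  | .leaf _ => 1
  | .node a s t => if l ∈ s.leaves then w a true * pathProd w l s else w a false * pathProd w l t

/-- Since `x` occurs only above the leaf `l`, the path to `x` is the path to `l` in `t` followed by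
the path to `x` in `φ l`. -/
theorem pathProd_bind [DecidableEq L] [DecidableEq M] (w : Υ → Bool → W) {t : PTree Υ L}
    (ht : t.leaves.Nodup) {φ : L → PTree Υ M} {l : L} {x : M} (hl : l ∈ t.leaves)
    (hx : x ∈ (φ l).leaves) (hd : ∀ l' ∈ t.leaves, l' ≠ l → x ∉ (φ l').leaves) :
    pathProd w x (t.bind φ) = pathProd w l t * pathProd w x (φ l) := by
  induction t with
  | leaf l' =>
    obtain rfl : l = l' := by simpa [leaves] using hl
    simp [pathProd, PTree.bind]
  | node a s t hs ht' =>
    simp only [leaves, List.mem_append] at hl hd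
    rw [leaves, List.nodup_append'] at ht
    have hmem : x ∈ (s.bind φ).leaves ↔ l ∈ s.leaves := by
      rw [leaves_bind, List.mem_flatMap]
      constructor
      · rintro ⟨l', h1, h2⟩
        by_cases h : l' = l
        · exact h ▸ h1
        · exact absurd h2 (hd l' (Or.inl h1) h)
      · exact fun h => ⟨l, h, hx⟩
    simp only [pathProd, PTree.bind, hmem]
    by_cases h : l ∈ s.leaves
    · rw [if_pos h, if_pos h, hs ht.1 h fun l' h1 => hd l' (Or.inl h1), mul_assoc]
    · rw [if_neg h, if_neg h, ht' ht.2.1 (hl.resolve_left h) fun l' h1 => hd l' (Or.inr h1),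
        mul_assoc]

theorem pathProd_graft {m n N : ℕ} {i : Fin m} {f : Fin m → Fin N} {g : Fin n → Fin N}
    (h : IsSymComposition i f g) (w : Υ → Bool → W) {s : PTree Υ (Fin m)} {t : PTree Υ (Fin n)}
    (hs : s.leaves.Nodup) (hs' : ∀ l, l ∈ s.leaves) (ht : t.leaves.Nodup)
    (ht' : ∀ l, l ∈ t.leaves) :
    (∀ j, j ≠ i → pathProd w (f j) (PTree.graft i f g s t) = pathProd w j s) ∧
      ∀ l, pathProd w (g l) (PTree.graft i f g s t) = pathProd w i s * pathProd w l t := by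
  obtain ⟨hf, hg, hfg, -⟩ := h
  constructor
  · intro j hj
    rw [PTree.graft, pathProd_bind w hs (hs' j)]
    · simp [hj, pathProd]
    · simp [hj, leaves]
    · intro l' _ hne
      by_cases hl : l' = i
      · simp only [if_pos hl, leaves_relabel, List.mem_map, not_exists, not_and]
        exact fun l _ e => hfg j hj l e.symm
      · simp only [if_neg hl, leaves, List.mem_singleton]
        exact fun e => hne (hf hl hj e.symm)
  · intro l
    rw [PTree.graft, pathProd_bind w hs (hs' i)]
    · simp only [if_true]
      rw [PTree.relabel, pathProd_bind w ht (ht' l)]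
      · simp [pathProd]
      · simp [leaves]
      · intro l' _ hne
        simpa [leaves] using fun e => hne (hg e.symm)
    · simp [leaves_relabel, ht']
    · intro l' _ hne
      simpa [if_neg hne, leaves] using fun e => hfg l' hne l e.symm

end Paths

/-! ### Quantum monomials as a totally ordered monoid. -/

namespace QMonomial

instance : Monoid QMonomial where
  one := 1
  mul := (· * ·)
  mul_assoc u v w := by
    show QMonomial.mk _ _ _ = QMonomial.mk _ _ _
    congr 1
    · exact add_assoc _ _ _
    · exact add_assoc _ _ _
    · show u.c + v.c + u.b * v.a + w.c + (u.b + v.b) * w.a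
        = u.c + (v.c + w.c + v.b * w.a) + u.b * (v.a + w.a)
      ring
  one_mul u := by
    show QMonomial.mk _ _ _ = u
    ext
    · exact zero_add _
    · exact zero_add _
    · show 0 + u.c + 0 * u.a = u.c
      ring
  mul_one u := by
    show QMonomial.mk _ _ _ = u
    ext <;> rfl

theorem lt_def (u v : QMonomial) : u < v ↔
    v.a < u.a ∨ (u.a = v.a ∧ u.b < v.b) ∨ (u.a = v.a ∧ u.b = v.b ∧ u.c < v.c) := Iff.rfl

theorem mul_a (u v : QMonomial) : (u * v).a = u.a + v.a := rfl
theorem mul_b (u v : QMonomial) : (u * v).b = u.b + v.b := rfl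
theorem mul_c (u v : QMonomial) : (u * v).c = u.c + v.c + u.b * v.a := rfl

instance : LinearOrder QMonomial where
  lt := (· < ·)
  le u v := u < v ∨ u = v
  le_refl u := Or.inr rfl
  le_trans u v w := by
    simp only [lt_def, QMonomial.ext_iff]; omega
  lt_iff_le_not_ge u v := by
    simp only [lt_def, QMonomial.ext_iff]; omega
  le_antisymm u v := by
    simp only [lt_def, QMonomial.ext_iff]; omega
  le_total u v := by
    simp only [lt_def, QMonomial.ext_iff]; omega
  toDecidableLE := Classical.decRel _

/-- The twist in the exponent of `q` is harmless because that exponent is compared last: on a tie in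
`a` (here) or in `b` (for right multiplication) both products acquire the same correction. -/
instance : MulLeftStrictMono QMonomial := ⟨fun u v w h => by
  rw [lt_def] at h
  show u * v < u * w
  simp only [lt_def, mul_a, mul_b, mul_c]
  rcases h with h | h | ⟨h1, h2, h3⟩
  · omega
  · omega
  · rw [h1]; omega⟩

instance : MulRightStrictMono QMonomial := ⟨fun u v w h => by
  rw [lt_def] at h
  show v * u < w * u
  simp only [lt_def, mul_a, mul_b, mul_c]
  rcases h with h | h | ⟨h1, h2, h3⟩
  · omega
  · omega
  · rw [h2]; omega⟩

end QMonomial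

theorem pathMonomial_eq_pathProd {Υ L : Type} [DecidableEq L] (w : Υ → QMonomial) (l : L)
    (t : PTree Υ L) : pathMonomial w l t = pathProd (fun a _ => w a) l t := by
  induction t with
  | leaf _ => rfl
  | node a s t hs ht =>
    simp only [pathMonomial, pathProd, hs, ht]
    split <;> rfl

/-! ### Lexicographic comparison of vectors -/

theorem ofFn_lt_ofFn_iff {W : Type} [LinearOrder W] {n : ℕ} {u v : Fin n → W} :
    List.ofFn u < List.ofFn v ↔ ∃ i, u i < v i ∧ ∀ j < i, u j = v j := by
  rw [List.lt_iff_exists]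
  simp only [List.length_ofFn, lt_irrefl, and_false, false_or, List.getElem_ofFn]
  constructor
  · rintro ⟨i, h1, h2, h3, h4⟩
    exact ⟨⟨i, h1⟩, h4, fun j hj => h3 j hj⟩
  · rintro ⟨i, h1, h2⟩
    exact ⟨i, i.2, i.2, fun j hj => h2 ⟨j, hj.trans i.2⟩ hj, h1⟩

section Composite

variable {W : Type} [Mul W] [LinearOrder W] [MulLeftStrictMono W]
  {m n N : ℕ} {i : Fin m} {f : Fin m → Fin N} {g : Fin n → Fin N}
  {u u' : Fin m → W} {v v' : Fin n → W} {w w' : Fin N → W}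

/-- With equal outer vectors the entries outside the range of `g` agree, so the first difference of
the inner vectors, at `l1`, becomes the first difference of the composites, at `g l1`. -/
theorem ofFn_composite_lt_of_eq (h : IsShuffleComposition i f g)
    (h1 : ∀ j, j ≠ i → w (f j) = u j) (h2 : ∀ l, w (g l) = u i * v l)
    (h1' : ∀ j, j ≠ i → w' (f j) = u j) (h2' : ∀ l, w' (g l) = u i * v' l)
    (hv : List.ofFn v < List.ofFn v') : List.ofFn w < List.ofFn w' := by
  obtain ⟨⟨-, -, hfg, hsurj⟩, hf, hg, hl⟩ := h
  obtain ⟨l1, h3, h4⟩ := ofFn_lt_ofFn_iff.1 hv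
  rw [ofFn_lt_ofFn_iff]
  refine ⟨g l1, ?_, fun q hq => ?_⟩
  · rw [h2, h2']; exact mul_lt_mul_right h3 _
  · rcases hsurj q with ⟨j, hj, rfl⟩ | ⟨l, rfl⟩
    · rw [h1 _ hj, h1' _ hj]
    · rw [h2, h2', h4 l (hg.lt_iff_lt.1 hq)]

variable [MulRightStrictMono W]

/-- Let `j0` be the first difference of the outer vectors. Labels below `f i` come from the outer
tree, and `f i` is itself the smallest inner label. If `j0 < i`, the difference shows up at `f j0`
before any inner label. If `j0 = i`, it shows up at `f i`, where the first inner entries can only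
help. If `i < j0`, the prefactor `u i` is common, and whichever of `f j0` and the first inner
difference comes earlier decides. -/
theorem ofFn_composite_lt_of_lt (h : IsShuffleComposition i f g)
    (h1 : ∀ j, j ≠ i → w (f j) = u j) (h2 : ∀ l, w (g l) = u i * v l)
    (h1' : ∀ j, j ≠ i → w' (f j) = u' j) (h2' : ∀ l, w' (g l) = u' i * v' l)
    (hu : List.ofFn u < List.ofFn u') (hv : List.ofFn v ≤ List.ofFn v') :
    List.ofFn w < List.ofFn w' := by
  obtain ⟨⟨-, -, hfg, hsurj⟩, hf, hg, hl⟩ := h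
  obtain ⟨j0, hj0, hlt⟩ := ofFn_lt_ofFn_iff.1 hu
  rw [ofFn_lt_ofFn_iff]
  obtain ⟨l0, hl0⟩ := hl.1
  have hl0' : ∀ l, l0 ≤ l := fun l => hg.le_iff_le.1 (hl0 ▸ hl.2 ⟨l, rfl⟩)
  have hbelow : ∀ q < f i, ∃ j, j ≠ i ∧ f j = q := by
    intro q hq
    rcases hsurj q with h | ⟨l, rfl⟩
    · exact h
    · exact absurd (hl.2 ⟨l, rfl⟩) (not_le.2 hq)
  rcases lt_trichotomy j0 i with hji | rfl | hij
  · refine ⟨f j0, by rwa [h1 _ hji.ne, h1' _ hji.ne], fun q hq => ?_⟩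
    obtain ⟨j, hj, rfl⟩ := hbelow q (hq.trans (hf hji))
    rw [h1 _ hj, h1' _ hj, hlt j (hf.lt_iff_lt.1 hq)]
  · refine ⟨f j0, ?_, fun q hq => ?_⟩
    · rw [← hl0, h2, h2']
      -- `l0` is the first index, and a lexicographic inequality implies the weak inequality of
      -- first entries.
      have : v l0 ≤ v' l0 := by
        rcases hv.lt_or_eq with hv | hv
        · obtain ⟨l1, h3, h4⟩ := ofFn_lt_ofFn_iff.1 hv
          rcases (hl0' l1).lt_or_eq with h5 | rfl
          · exact (h4 _ h5).le
          · exact h3.le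
        · rw [List.ofFn_injective hv]
      rcases this.lt_or_eq with h | h
      · exact (mul_lt_mul_left hj0 _).trans (mul_lt_mul_right h _)
      · rw [h]; exact mul_lt_mul_left hj0 _
    · obtain ⟨j, hj, rfl⟩ := hbelow q hq
      rw [h1 _ hj, h1' _ hj, hlt j (hf.lt_iff_lt.1 hq)]
  · have hui : u i = u' i := hlt i hij
    rcases hv.lt_or_eq with hv | hv
    · obtain ⟨l1, h3, h4⟩ := ofFn_lt_ofFn_iff.1 hv
      rcases lt_or_ge (g l1) (f j0) with hlj | hjl
      · refine ⟨g l1, ?_, fun q hq => ?_⟩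
        · rw [h2, h2', hui]; exact mul_lt_mul_right h3 _
        · rcases hsurj q with ⟨j, hj, rfl⟩ | ⟨l, rfl⟩
          · rw [h1 _ hj, h1' _ hj, hlt j (hf.lt_iff_lt.1 (hq.trans hlj))]
          · rw [h2, h2', hui, h4 l (hg.lt_iff_lt.1 hq)]
      · refine ⟨f j0, by rwa [h1 _ hij.ne', h1' _ hij.ne'], fun q hq => ?_⟩
        rcases hsurj q with ⟨j, hj, rfl⟩ | ⟨l, rfl⟩
        · rw [h1 _ hj, h1' _ hj, hlt j (hf.lt_iff_lt.1 hq)]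
        · rw [h2, h2', hui, h4 l (hg.lt_iff_lt.1 (hq.trans_le hjl))]
    · obtain rfl := List.ofFn_injective hv
      refine ⟨f j0, by rwa [h1 _ hij.ne', h1' _ hij.ne'], fun q hq => ?_⟩
      rcases hsurj q with ⟨j, hj, rfl⟩ | ⟨l, rfl⟩
      · rw [h1 _ hj, h1' _ hj, hlt j (hf.lt_iff_lt.1 hq)]
      · rw [h2, h2', hui]

/-- Composition is monotone for the lexicographic order of vectors, and strictly so. -/
theorem ofFn_composite_le (h : IsShuffleComposition i f g)
    (h1 : ∀ j, j ≠ i → w (f j) = u j) (h2 : ∀ l, w (g l) = u i * v l)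
    (h1' : ∀ j, j ≠ i → w' (f j) = u' j) (h2' : ∀ l, w' (g l) = u' i * v' l)
    (hu : List.ofFn u ≤ List.ofFn u') (hv : List.ofFn v ≤ List.ofFn v') :
    List.ofFn w < List.ofFn w' ∨ (List.ofFn w = List.ofFn w' ∧ u = u' ∧ v = v') := by
  rcases hu.lt_or_eq with hu | hu
  · exact Or.inl (ofFn_composite_lt_of_lt h h1 h2 h1' h2' hu hv)
  · obtain rfl := List.ofFn_injective hu
    rcases hv.lt_or_eq with hv | hv
    · exact Or.inl (ofFn_composite_lt_of_eq h h1 h2 h1' h2' hv)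
    · obtain rfl := List.ofFn_injective hv
      refine Or.inr ⟨congrArg _ (funext fun q => ?_), rfl, rfl⟩
      rcases h.1.2.2.2 q with ⟨j, hj, rfl⟩ | ⟨l, rfl⟩
      · rw [h1 _ hj, h1' _ hj]
      · rw [h2, h2']

end Composite

/-! ### An admissible ordering extending the QM-ordering -/

/-- Words in an alphabet of six letters, encoded by the length and the number with these digits in
base `6`. -/
@[ext]
structure WordCode where
  len : ℕ
  val : ℕ

namespace WordCode

/-- The product is concatenation. The length has to be stored because leading digits may be zero. -/
instance : Monoid WordCode where
  one := ⟨0, 0⟩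
  mul u v := ⟨u.len + v.len, u.val * 6 ^ v.len + v.val⟩
  mul_assoc u v w := by
    show WordCode.mk _ _ = WordCode.mk _ _
    congr 1
    · exact add_assoc _ _ _
    · show (u.val * 6 ^ v.len + v.val) * 6 ^ w.len + w.val
        = u.val * 6 ^ (v.len + w.len) + (v.val * 6 ^ w.len + w.val)
      ring
  one_mul u := by
    show WordCode.mk _ _ = u
    ext
    · exact zero_add _
    · show 0 * _ + u.val = u.val
      ring
  mul_one u := by
    show WordCode.mk _ _ = u
    ext
    · rfl
    · show u.val * 6 ^ 0 + 0 = u.val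
      ring

theorem one_len : (1 : WordCode).len = 0 := rfl
theorem one_val : (1 : WordCode).val = 0 := rfl
theorem mul_len (u v : WordCode) : (u * v).len = u.len + v.len := rfl
theorem mul_val (u v : WordCode) : (u * v).val = u.val * 6 ^ v.len + v.val := rfl

instance : LinearOrder WordCode where
  lt u v := u.len < v.len ∨ (u.len = v.len ∧ u.val < v.val)
  le u v := u.len < v.len ∨ (u.len = v.len ∧ u.val ≤ v.val)
  le_refl u := by omega
  le_trans u v w := by omega
  lt_iff_le_not_ge u v := by omega
  le_antisymm u v := by simp only [WordCode.ext_iff]; omega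
  le_total u v := by omega
  toDecidableLE := Classical.decRel _

theorem lt_def (u v : WordCode) : u < v ↔ u.len < v.len ∨ (u.len = v.len ∧ u.val < v.val) :=
  Iff.rfl

instance : MulLeftStrictMono WordCode := ⟨fun u v w h => by
  rw [lt_def] at h
  show u * v < u * w
  simp only [lt_def, mul_len, mul_val]
  rcases h with h | ⟨h1, h2⟩
  · omega
  · rw [h1]; omega⟩

instance : MulRightStrictMono WordCode := ⟨fun u v w h => by
  rw [lt_def] at h
  show v * u < w * u
  simp only [lt_def, mul_len, mul_val]
  rcases h with h | ⟨h1, h2⟩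
  · omega
  · refine Or.inr ⟨by omega, ?_⟩
    have := Nat.mul_lt_mul_of_pos_right h2 (pow_pos (by norm_num : 0 < 6) u.len)
    omega⟩

/-- The letter for a step from the output of a vertex to its left or right input. -/
def letter : ShGen → Bool → WordCode
  | .β, true => ⟨1, 0⟩
  | .β, false => ⟨1, 1⟩
  | .d, true => ⟨1, 2⟩
  | .d, false => ⟨1, 3⟩
  | .e, true => ⟨1, 4⟩
  | .e, false => ⟨1, 5⟩

theorem letter_len (a : ShGen) (b : Bool) : (letter a b).len = 1 := by
  cases a <;> cases b <;> rfl

theorem letter_val_lt (a : ShGen) (b : Bool) : (letter a b).val < 6 := by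
  cases a <;> cases b <;> simp [letter]

theorem letter_val_injective {a a' : ShGen} {b b' : Bool}
    (h : (letter a b).val = (letter a' b').val) : a = a' ∧ b = b' := by
  cases a <;> cases b <;> cases a' <;> cases b' <;> simp [letter] at h ⊢

/-- The digit bounds make the first letter the quotient, and the rest the remainder, of division by
the power of 6 given by the length of the rest. -/
theorem letter_mul_injective {a a' : ShGen} {b b' : Bool} {u u' : WordCode}
    (hu : u.val < 6 ^ u.len) (hu' : u'.val < 6 ^ u'.len)
    (h : letter a b * u = letter a' b' * u') : a = a' ∧ b = b' ∧ u = u' := by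
  rw [WordCode.ext_iff, mul_len, mul_len, mul_val, mul_val, letter_len, letter_len] at h
  obtain ⟨h1, h2⟩ := h
  have h1 : u.len = u'.len := by omega
  rw [← h1] at h2 hu'
  have h3 := congrArg (· / 6 ^ u.len) h2
  have h4 := congrArg (· % 6 ^ u.len) h2
  have hp : 0 < 6 ^ u.len := pow_pos (by norm_num) _
  simp only [Nat.mul_comm _ (6 ^ u.len), Nat.mul_add_mod,
    Nat.mul_add_div hp, Nat.mod_eq_of_lt hu, Nat.mod_eq_of_lt hu', Nat.div_eq_of_lt hu,
    Nat.div_eq_of_lt hu', add_zero] at h3 h4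
  obtain ⟨ha, hb⟩ := letter_val_injective h3
  exact ⟨ha, hb, WordCode.ext h1 h4⟩

theorem pathProd_val_lt {L : Type} [DecidableEq L] (l : L) (t : PTree ShGen L) :
    (pathProd letter l t).val < 6 ^ (pathProd letter l t).len := by
  have key : ∀ a b (u : WordCode), u.val < 6 ^ u.len →
      (letter a b * u).val < 6 ^ (letter a b * u).len := by
    intro a b u hu
    rw [mul_val, mul_len, letter_len, pow_add]
    have := letter_val_lt a b
    have := Nat.mul_le_mul_right (6 ^ u.len) (Nat.le_of_lt_succ this)
    omega
  induction t with
  | leaf l' => simp [pathProd, one_len, one_val]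
  | node a s t hs ht =>
    simp only [pathProd]
    split
    · exact key _ _ _ hs
    · exact key _ _ _ ht

/-- A tree is determined by the words read along the paths from the root to the leaves. -/
theorem eq_of_pathProd_eq {L : Type} [DecidableEq L] {t t' : PTree ShGen L}
    (ht : t.leaves.Nodup) (ht' : t'.leaves.Nodup) (hl : ∀ l, l ∈ t.leaves ↔ l ∈ t'.leaves)
    (h : ∀ l ∈ t.leaves, pathProd letter l t = pathProd letter l t') : t = t' := by
  induction t generalizing t' with
  | leaf l =>
    cases t' with
    | leaf l' =>
      have := (hl l).1 (by simp [leaves])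
      simp only [leaves, List.mem_singleton] at this
      rw [this]
    | node a s u =>
      have := h l (by simp [leaves])
      have := congrArg len this
      simp only [pathProd, one_len] at this
      split at this <;> rw [mul_len, letter_len] at this <;> omega
  | node a s u hs hu =>
    cases t' with
    | leaf l =>
      obtain ⟨l', hl'⟩ := List.exists_mem_of_ne_nil _ (leaves_ne_nil (node a s u))
      have := h l' hl'
      have := congrArg len this
      simp only [pathProd, one_len] at this
      split at this <;> rw [mul_len, letter_len] at this <;> omega
    | node a' s' u' =>
      rw [leaves, List.nodup_append'] at ht ht'
      simp only [leaves, List.mem_append] at hl h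
      -- The first letter of the word of a leaf names the generator at the root and the side on
      -- which the leaf lies. Equal words therefore force equal roots and equal distributions of the
      -- labels over the two branches.
      have key : ∀ l, (l ∈ s.leaves → a = a' ∧ l ∈ s'.leaves ∧
            pathProd letter l s = pathProd letter l s') ∧
          (l ∈ u.leaves → a = a' ∧ l ∈ u'.leaves ∧
            pathProd letter l u = pathProd letter l u') := by
        intro l
        constructor
        · intro hls
          have := h l (Or.inl hls)
          simp only [pathProd, if_pos hls] at this
          split at this
          next hls' =>
            obtain ⟨h1, h2, h3⟩ := letter_mul_injective (pathProd_val_lt _ _)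
              (pathProd_val_lt _ _) this
            exact ⟨h1, hls', h3⟩
          next =>
            obtain ⟨h1, h2, h3⟩ := letter_mul_injective (pathProd_val_lt _ _)
              (pathProd_val_lt _ _) this
            simp at h2
        · intro hlu
          have hls : l ∉ s.leaves := fun hls => ht.2.2 hls hlu
          have := h l (Or.inr hlu)
          simp only [pathProd, if_neg hls] at this
          split at this
          next =>
            obtain ⟨h1, h2, h3⟩ := letter_mul_injective (pathProd_val_lt _ _)
              (pathProd_val_lt _ _) this
            simp at h2
          next hls' =>
            obtain ⟨h1, h2, h3⟩ := letter_mul_injective (pathProd_val_lt _ _)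
              (pathProd_val_lt _ _) this
            exact ⟨h1, ((hl l).1 (Or.inr hlu)).resolve_left hls', h3⟩
      obtain rfl := ((key _).1 (List.getElem_mem (List.length_pos_of_ne_nil
        (leaves_ne_nil s)))).1
      rw [hs ht.1 ht'.1 (fun l => ⟨fun hl' => ((key l).1 hl').2.1, fun hl' =>
          ((hl l).2 (Or.inl hl')).resolve_right fun hu => ht'.2.2 hl' ((key l).2 hu).2.1⟩)
          fun l hl' => ((key l).1 hl').2.2,
        hu ht.2.1 ht'.2.1 (fun l => ⟨fun hl' => ((key l).2 hl').2.1, fun hl' =>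
          ((hl l).2 (Or.inr hl')).resolve_left fun hs => ht'.2.2 ((key l).1 hs).2.1 hl'⟩)
          fun l hl' => ((key l).2 hl').2.2]

end WordCode

/-- The vector of the words read along the paths from the root to the leaves. -/
def wordVector (α : TreeMonomial shSignature) : List WordCode :=
  List.ofFn fun l => pathProd WordCode.letter l α.tree

/-- A numbering of the colours. -/
def colourCode : Colour → ℕ
  | lie => 0
  | mod => 1

theorem colourCode_injective : Function.Injective colourCode := by
  intro a b h
  cases a <;> cases b <;> simp_all [colourCode]

/-- The key by which tree monomials are sorted. -/
def sortKey (w : ShGen → QMonomial) (α : TreeMonomial shSignature) :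
    ℕ ×ₗ List QMonomial ×ₗ List WordCode ×ₗ ℕ :=
  toLex (α.arity, toLex (pathVector w α, toLex (wordVector α, colourCode α.colour)))

/-- The words determine the tree, and every leaf below a vertex gets its colour from that vertex.
The output colour is needed for the tree that is a single leaf, which does not determine its colour.
-/
theorem eq_of_wordVector_eq {α β : TreeMonomial shSignature} (h1 : α.arity = β.arity)
    (h2 : wordVector α = wordVector β) (h3 : α.colour = β.colour) : α = β := by
  obtain ⟨n, χ, c, t, ht⟩ := α
  obtain ⟨n', χ', c', t', ht'⟩ := β
  obtain rfl : n = n' := h1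
  obtain rfl : c = c' := h3
  obtain rfl : t = t' := by
    have := List.ofFn_injective h2
    refine WordCode.eq_of_pathProd_eq ht.1.2.2.1 ht'.1.2.2.1 (fun l => ?_) fun l _ =>
      congrFun this l
    exact iff_of_true (ht.1.2.2.2 l) (ht'.1.2.2.2 l)
  obtain rfl : χ = χ' := by
    have key : ∀ u : PTree ShGen (Fin n), WellColoured shSignature χ u →
        WellColoured shSignature χ' u → rootColour shSignature χ u = rootColour shSignature χ' u →
        ∀ l ∈ u.leaves, χ l = χ' l := by
      intro u
      induction u with
      | leaf l => simp [leaves, rootColour]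
      | node a s u hs hu =>
        rintro ⟨a1, a2, a3, a4⟩ ⟨b1, b2, b3, b4⟩ - l hl
        rcases List.mem_append.1 hl with hl | hl
        · exact hs a1 b1 (a3.trans b3.symm) l hl
        · exact hu a2 b2 (a4.trans b4.symm) l hl
    exact funext fun l => key t ht.1.1 ht'.1.1 (ht.1.2.1.trans ht'.1.2.1.symm) l (ht.1.2.2.2 l)
  rfl

theorem sortKey_injective (w : ShGen → QMonomial) : Function.Injective (sortKey w) := by
  intro α β h
  have h := congrArg ofLex h
  simp only [sortKey, ofLex_toLex, Prod.mk.injEq] at h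
  obtain ⟨h1, h2⟩ := h
  have h2 := congrArg ofLex h2
  simp only [ofLex_toLex, Prod.mk.injEq] at h2
  have h3 := congrArg ofLex h2.2
  simp only [ofLex_toLex, Prod.mk.injEq] at h3
  exact eq_of_wordVector_eq h1 h3.1 (colourCode_injective h3.2)

theorem sortKey_le_iff (w : ShGen → QMonomial) {α β : TreeMonomial shSignature} :
    sortKey w α ≤ sortKey w β ↔ α.arity < β.arity ∨ (α.arity = β.arity ∧
      (pathVector w α < pathVector w β ∨ (pathVector w α = pathVector w β ∧
        (wordVector α < wordVector β ∨ (wordVector α = wordVector β ∧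
          colourCode α.colour ≤ colourCode β.colour))))) := by
  simp only [sortKey, Prod.Lex.toLex_le_toLex]

/-- Sorting by the key is an admissible ordering. -/
theorem isAdmissible_sortKey (w : ShGen → QMonomial) :
    IsAdmissible shSignature fun α β => sortKey w α ≤ sortKey w β where
  refl _ := le_rfl
  trans _ _ _ := le_trans
  antisymm _ _ h h' := sortKey_injective w (le_antisymm h h')
  total _ _ := le_total _ _
  arity α β h := (sortKey_le_iff w).2 (Or.inl h)
  comp i f g χ₁ χ₁' χ₂ χ₂' χ χ' c c' s s' t t' hs hs' ht ht' h h' hc _ _ hle hle' := by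
    rw [sortKey_le_iff] at hle hle' ⊢
    simp only [lt_irrefl, false_or, true_and, pathVector, wordVector,
      pathMonomial_eq_pathProd] at hle hle' ⊢
    obtain ⟨a1, a2⟩ := pathProd_graft hc.1 (fun a _ => w a) hs.1.2.2.1 hs.1.2.2.2 ht.1.2.2.1
      ht.1.2.2.2
    obtain ⟨a1', a2'⟩ := pathProd_graft hc.1 (fun a _ => w a) hs'.1.2.2.1 hs'.1.2.2.2
      ht'.1.2.2.1 ht'.1.2.2.2
    obtain ⟨b1, b2⟩ := pathProd_graft hc.1 WordCode.letter hs.1.2.2.1 hs.1.2.2.2 ht.1.2.2.1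
      ht.1.2.2.2
    obtain ⟨b1', b2'⟩ := pathProd_graft hc.1 WordCode.letter hs'.1.2.2.1 hs'.1.2.2.2
      ht'.1.2.2.1 ht'.1.2.2.2
    have e1 := hle.elim le_of_lt fun h => le_of_eq h.1
    have e2 := hle'.elim le_of_lt fun h => le_of_eq h.1
    -- A tie between the composites occurs only when both factors are tied, so the comparison of the
    -- factors passes to the next component of the key. In the end the output colour of a composite
    -- is that of the outer tree.
    rcases ofFn_composite_le (w := fun q => pathProd (fun a _ => w a) q (graft i f g s t))
      (w' := fun q => pathProd (fun a _ => w a) q (graft i f g s' t')) hc a1 a2 a1' a2' e1 e2 with h1 | ⟨h1, h2, h3⟩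
    · exact Or.inl h1
    · refine Or.inr ⟨h1, ?_⟩
      have hle := (hle.resolve_left (by rw [h2]; exact lt_irrefl _)).2
      have hle' := (hle'.resolve_left (by rw [h3]; exact lt_irrefl _)).2
      have e1 := hle.elim le_of_lt fun h => le_of_eq h.1
      have e2 := hle'.elim le_of_lt fun h => le_of_eq h.1
      rcases ofFn_composite_le (w := fun q => pathProd WordCode.letter q (graft i f g s t))
        (w' := fun q => pathProd WordCode.letter q (graft i f g s' t')) hc b1 b2 b1' b2' e1 e2 with h1 | ⟨h1, h2, h3⟩
      · exact Or.inl h1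
      · exact Or.inr ⟨h1, (hle.resolve_left (by rw [h2]; exact lt_irrefl _)).2⟩

theorem extendsQM_sortKey (w : ShGen → QMonomial) :
    ExtendsQM w fun α β => sortKey w α ≤ sortKey w β := by
  intro α β h
  rw [sortKey_le_iff]
  exact h.imp_right fun h => ⟨h.1, Or.inl h.2⟩

/-! ### The quadratic relations -/

/-- The four shuffle relations: the Jacobi identity, and the compatibility of the action with the
bracket, for the three possible positions of the module element. -/
inductive Relator
  | jacobi
  | actThird
  | actSecond
  | actFirst

namespace Relator

/-- The colours of the leaves. -/
def colouring : Relator → Fin 3 → Colour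
  | jacobi => ![lie, lie, lie]
  | actThird => ![lie, lie, mod]
  | actSecond => ![lie, mod, lie]
  | actFirst => ![mod, lie, lie]

/-- The output colour. -/
def colour : Relator → Colour
  | jacobi => lie
  | actThird => mod
  | actSecond => mod
  | actFirst => mod

/-- The leading tree. -/
def lead : Relator → PTree ShGen (Fin 3)
  | jacobi => node .β (node .β (leaf 0) (leaf 1)) (leaf 2)
  | actThird => node .d (node .β (leaf 0) (leaf 1)) (leaf 2)
  | actSecond => node .d (node .β (leaf 0) (leaf 2)) (leaf 1)
  | actFirst => node .e (leaf 0) (node .β (leaf 1) (leaf 2))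

/-- The first of the lower trees. -/
def fst : Relator → PTree ShGen (Fin 3)
  | jacobi => node .β (node .β (leaf 0) (leaf 2)) (leaf 1)
  | actThird => node .d (leaf 0) (node .d (leaf 1) (leaf 2))
  | actSecond => node .d (leaf 0) (node .e (leaf 1) (leaf 2))
  | actFirst => node .e (node .e (leaf 0) (leaf 2)) (leaf 1)

/-- The second of the lower trees. -/
def snd : Relator → PTree ShGen (Fin 3)
  | jacobi => node .β (leaf 0) (node .β (leaf 1) (leaf 2))
  | actThird => node .e (node .d (leaf 0) (leaf 2)) (leaf 1)
  | actSecond => node .e (node .d (leaf 0) (leaf 1)) (leaf 2)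
  | actFirst => node .e (node .e (leaf 0) (leaf 1)) (leaf 2)

/-- The coefficient of the second of the lower trees. -/
def coeff (k : Type*) [Field k] : Relator → k
  | jacobi => -1
  | _ => 1

/-- The relation. -/
def element (k : Type*) [Field k] (ρ : Relator) : PTree ShGen (Fin 3) →₀ k :=
  .single ρ.lead 1 - .single ρ.fst 1 + ρ.coeff k • .single ρ.snd 1

theorem isShuffleTree_lead (ρ : Relator) :
    IsShuffleTree shSignature ρ.colouring ρ.colour ρ.lead := by
  cases ρ <;> refine ⟨⟨?_, ?_, by decide, by decide⟩, ?_⟩ <;>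
    simp [lead, colouring, colour, WellColoured, rootColour, shSignature, IsShuffle, minLabel,
      Fin.lt_def]

theorem isShuffleTree_fst (ρ : Relator) :
    IsShuffleTree shSignature ρ.colouring ρ.colour ρ.fst := by
  cases ρ <;> refine ⟨⟨?_, ?_, by decide, by decide⟩, ?_⟩ <;>
    simp [fst, colouring, colour, WellColoured, rootColour, shSignature, IsShuffle, minLabel,
      Fin.lt_def]

theorem isShuffleTree_snd (ρ : Relator) :
    IsShuffleTree shSignature ρ.colouring ρ.colour ρ.snd := by
  cases ρ <;> refine ⟨⟨?_, ?_, by decide, by decide⟩, ?_⟩ <;>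
    simp [snd, colouring, colour, WellColoured, rootColour, shSignature, IsShuffle, minLabel,
      Fin.lt_def]

theorem support_element {k : Type*} [Field k] {ρ : Relator} {t : PTree ShGen (Fin 3)}
    (ht : t ∈ (ρ.element k).support) : t = ρ.lead ∨ t = ρ.fst ∨ t = ρ.snd := by
  by_contra! h
  classical
  simp [element, h.1.symm, h.2.1.symm, h.2.2.symm] at ht

theorem element_mem_freeShuffle {k : Type*} [Field k] (ρ : Relator) :
    ρ.element k ∈ freeShuffle k shSignature ρ.colouring ρ.colour := by
  intro t ht
  rcases support_element ht with rfl | rfl | rfl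
  exacts [ρ.isShuffleTree_lead, ρ.isShuffleTree_fst, ρ.isShuffleTree_snd]

theorem vertices_eq_two {k : Type*} [Field k] {ρ : Relator} {t : PTree ShGen (Fin 3)}
    (ht : t ∈ (ρ.element k).support) : t.vertices = 2 := by
  rcases support_element ht with rfl | rfl | rfl <;> cases ρ <;> rfl

end Relator

/-- The set of quadratic relations. -/
inductive IsRelator (k : Type*) [Field k] :
    ∀ n : ℕ, (Fin n → Colour) → Colour → (PTree ShGen (Fin n) →₀ k) → Prop
  | mk (ρ : Relator) : IsRelator k 3 ρ.colouring ρ.colour (ρ.element k)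

/-- The family of quadratic relations. -/
def relators (k : Type*) [Field k] : Family k Colour ShGen := fun n χ c => {x | IsRelator k n χ c x}

theorem isQuadratic_relators (k : Type*) [Field k] : IsQuadratic (relators k) := by
  rintro n χ c x ⟨ρ⟩ t ht
  exact Relator.vertices_eq_two ht

/-! ### Comparison of trees by the monomials of their paths -/

/-- The tree `u` is smaller than `t` in the lexicographic order of the monomials of the paths to the
leaves labelled by elements of `A`. -/
def PathLT {L : Type} [LinearOrder L] (A : Finset L) (u t : PTree ShGen L) : Prop :=
  ∃ p ∈ A, pathMonomial mlieWeight p u < pathMonomial mlieWeight p t ∧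
    ∀ q ∈ A, q < p → pathMonomial mlieWeight q u = pathMonomial mlieWeight q t

theorem pathLT_univ_iff {n : ℕ} {u t : PTree ShGen (Fin n)} : PathLT Finset.univ u t ↔
    List.ofFn (fun l => pathMonomial mlieWeight l u) <
      List.ofFn (fun l => pathMonomial mlieWeight l t) := by
  simp only [ofFn_lt_ofFn_iff, PathLT, Finset.mem_univ, true_and, forall_const]

theorem PathLT.qmLt {n : ℕ} {χ χ' : Fin n → Colour} {c c' : Colour} {u t : PTree ShGen (Fin n)}
    (h : PathLT Finset.univ u t) (hu : IsShuffleTree shSignature χ c u)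
    (ht : IsShuffleTree shSignature χ' c' t) :
    QMLt mlieWeight ⟨n, χ, c, u, hu⟩ ⟨n, χ', c', t, ht⟩ :=
  Or.inr ⟨rfl, pathLT_univ_iff.1 h⟩

theorem PathLT.ne {L : Type} [LinearOrder L] {A : Finset L} {u t : PTree ShGen L}
    (h : PathLT A u t) : u ≠ t := by
  rintro rfl
  obtain ⟨p, -, h, -⟩ := h
  exact lt_irrefl _ h

theorem PathLT.trans {n : ℕ} {u v t : PTree ShGen (Fin n)} (h : PathLT Finset.univ u v)
    (h' : PathLT Finset.univ v t) : PathLT Finset.univ u t := by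
  rw [pathLT_univ_iff] at *
  exact h.trans h'

namespace Relator

/-- For the Jacobi identity leaf 0 has y² in both trees, and leaf 1 decides by y < y². For the
action leaf 0 decides: x < xy with the module input third or second, and x² < x with the module
input first, a higher power of x being smaller. -/
theorem pathLT_fst (ρ : Relator) : PathLT Finset.univ ρ.fst ρ.lead := by
  cases ρ
  case jacobi =>
    refine ⟨1, Finset.mem_univ _, ?_, ?_⟩
    · simp [fst, lead, pathMonomial_eq_pathProd, pathProd, leaves, mlieWeight, QMonomial.lt_def,
        QMonomial.y, QMonomial.mul_a, QMonomial.mul_b, QMonomial.mul_c]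
    · simp [fst, lead, pathMonomial_eq_pathProd, pathProd, leaves]
  all_goals
    refine ⟨0, Finset.mem_univ _, ?_, fun q _ h => absurd h (Fin.not_lt_zero q)⟩
    simp [fst, lead, pathMonomial_eq_pathProd, pathProd, leaves, mlieWeight, QMonomial.lt_def,
        QMonomial.x, QMonomial.y, QMonomial.mul_a, QMonomial.mul_b, QMonomial.mul_c]

/-- Leaf 0 always decides: y < y² for the Jacobi identity, x² < xy or x² < x for the action. -/
theorem pathLT_snd (ρ : Relator) : PathLT Finset.univ ρ.snd ρ.lead := by
  refine ⟨0, Finset.mem_univ _, ?_, fun q _ h => absurd h (Fin.not_lt_zero q)⟩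
  cases ρ <;>
  simp [snd, lead, pathMonomial_eq_pathProd, pathProd, leaves, mlieWeight, QMonomial.lt_def,
        QMonomial.x, QMonomial.y, QMonomial.mul_a, QMonomial.mul_b, QMonomial.mul_c]

theorem isLeadingTerm_lead {k : Type*} [Field k]
    {r : TreeMonomial shSignature → TreeMonomial shSignature → Prop}
    (hr : IsAdmissible shSignature r) (hq : ExtendsQM mlieWeight r) (ρ : Relator) :
    IsLeadingTerm shSignature r ρ.colouring ρ.colour (ρ.element k) ρ.lead := by
  refine ⟨?_, ρ.isShuffleTree_lead, fun s hs => ?_⟩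
  · classical
    simp [element, ρ.pathLT_fst.ne, ρ.pathLT_snd.ne]
  · rcases support_element hs with rfl | rfl | rfl
    · exact ⟨ρ.isShuffleTree_lead, hr.refl _⟩
    · exact ⟨ρ.isShuffleTree_fst, hq _ _ (ρ.pathLT_fst.qmLt _ _)⟩
    · exact ⟨ρ.isShuffleTree_snd, hq _ _ (ρ.pathLT_snd.qmLt _ _)⟩

end Relator

/-! ### The ideal generated by the quadratic relations consists of relations -/

theorem leaves_toSym_perm {L : Type} (t : PTree ShGen L) :
    (toSym t).leaves.Perm t.leaves := by
  induction t with
  | leaf l => exact List.Perm.refl _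
  | node a s t hs ht =>
    cases a
    · exact hs.append ht
    · exact hs.append ht
    · exact (ht.append hs).trans List.perm_append_comm

theorem mem_leaves_toSym {L : Type} {t : PTree ShGen L} {l : L} :
    l ∈ (toSym t).leaves ↔ l ∈ t.leaves :=
  (leaves_toSym_perm t).mem_iff

theorem toSym_bind {L M : Type} (t : PTree ShGen L) (φ : L → PTree ShGen M) :
    toSym (t.bind φ) = (toSym t).bind fun l => toSym (φ l) := by
  induction t with
  | leaf l => rfl
  | node a s t hs ht => cases a <;> simp [PTree.bind, toSym, hs, ht]

theorem toSym_graft {m n N : ℕ} (i : Fin m) (f : Fin m → Fin N) (g : Fin n → Fin N)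
    (s : PTree ShGen (Fin m)) (t : PTree ShGen (Fin n)) :
    toSym (graft i f g s t) = graft i f g (toSym s) (toSym t) := by
  rw [graft, graft, toSym_bind]
  congr 1
  funext j
  by_cases hj : j = i
  · simp only [if_pos hj, PTree.relabel, toSym_bind]; rfl
  · simp only [if_neg hj]; rfl

theorem rootColour_toSym {L : Type} (χ : L → Colour) (t : PTree ShGen L) :
    rootColour symSignature χ (toSym t) = rootColour shSignature χ t := by
  cases t with
  | leaf l => rfl
  | node a s t => cases a <;> rfl

theorem wellColoured_toSym {L : Type} {χ : L → Colour} {t : PTree ShGen L}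
    (h : WellColoured shSignature χ t) : WellColoured symSignature χ (toSym t) := by
  induction t with
  | leaf l => trivial
  | node a s t hs ht =>
    obtain ⟨h1, h2, h3, h4⟩ := h
    cases a
    · exact ⟨hs h1, ht h2, (rootColour_toSym _ _).trans h3, (rootColour_toSym _ _).trans h4⟩
    · exact ⟨hs h1, ht h2, (rootColour_toSym _ _).trans h3, (rootColour_toSym _ _).trans h4⟩
    · exact ⟨ht h2, hs h1, (rootColour_toSym _ _).trans h4, (rootColour_toSym _ _).trans h3⟩

theorem isColouredTree_toSym {n : ℕ} {χ : Fin n → Colour} {c : Colour} {t : PTree ShGen (Fin n)}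
    (h : IsShuffleTree shSignature χ c t) : IsColouredTree symSignature χ c (toSym t) :=
  ⟨wellColoured_toSym h.1.1, (rootColour_toSym _ _).trans h.1.2.1,
    (leaves_toSym_perm t).nodup_iff.2 h.1.2.2.1, fun l => mem_leaves_toSym.2 (h.1.2.2.2 l)⟩

variable {k : Type*} [Field k]

theorem mapDomain_toSym_comp {m n N : ℕ} (i : Fin m) (f : Fin m → Fin N) (g : Fin n → Fin N)
    (x : PTree ShGen (Fin m) →₀ k) (y : PTree ShGen (Fin n) →₀ k) :
    (comp i f g x y).mapDomain toSym = comp i f g (x.mapDomain toSym) (y.mapDomain toSym) := by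
  simp only [comp]
  rw [Finsupp.mapDomain, Finsupp.sum_sum_index (by simp) (by simp [Finsupp.single_add]),
    Finsupp.sum_mapDomain_index (by simp) (by simp [add_mul, Finsupp.sum_add])]
  refine Finsupp.sum_congr fun s _ => ?_
  rw [Finsupp.sum_sum_index (by simp) (by simp [Finsupp.single_add]),
    Finsupp.sum_mapDomain_index (by simp) (by simp [mul_add])]
  refine Finsupp.sum_congr fun t _ => ?_
  rw [Finsupp.sum_single_index (by simp), toSym_graft]

theorem mapDomain_toSym_mem_freeSym {n : ℕ} {χ : Fin n → Colour} {c : Colour}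
    {x : PTree ShGen (Fin n) →₀ k} (hx : x ∈ freeShuffle k shSignature χ c) :
    x.mapDomain toSym ∈ freeSym k symSignature χ c := by
  classical
  intro t ht
  obtain ⟨s, hs, rfl⟩ := Finset.mem_image.1 (Finsupp.mapDomain_support ht)
  exact isColouredTree_toSym (hx hs)

theorem comp_mem_freeShuffle {I Υ : Type} {S : Signature I Υ} {m n N : ℕ} {i : Fin m}
    {f : Fin m → Fin N} {g : Fin n → Fin N} {χ₁ : Fin m → I} {χ₂ : Fin n → I} {χ : Fin N → I}
    {c : I} (h : IsShuffleComposition i f g) (hχ : IsCompositeColouring i f g χ₁ χ₂ χ)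
    {x : PTree Υ (Fin m) →₀ k} {y : PTree Υ (Fin n) →₀ k} (hx : x ∈ freeShuffle k S χ₁ c)
    (hy : y ∈ freeShuffle k S χ₂ (χ₁ i)) : comp i f g x y ∈ freeShuffle k S χ c := by
  refine Submodule.sum_mem _ fun s hs => Submodule.sum_mem _ fun t ht => ?_
  exact Finsupp.single_mem_supported k _ (isShuffleTree_graft h hχ (hx hs) (hy ht))

/-- A permutation of the labels is the composition with a one-leaf tree as outer factor. The value
of `f` at that leaf plays no role, and `g 0` is a filler. -/
theorem InSymIdeal.relabel {I Υ : Type} {S : Signature I Υ} {R : Family k I Υ} {n : ℕ}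
    [NeZero n] {χ χ' : Fin n → I} {c : I} {x : PTree Υ (Fin n) →₀ k} {g : Fin n → Fin n}
    (hg : Function.Bijective g) (hχ : χ' ∘ g = χ) (hx : InSymIdeal S R χ c x) :
    InSymIdeal S R χ' c (x.mapDomain (PTree.relabel g)) := by
  have key : x.mapDomain (PTree.relabel g) =
    comp (0 : Fin 1) (fun _ => g 0) g (.single (leaf 0) 1) x := by
    rw [comp, Finsupp.sum_single_index (by simp)]
    simp [Finsupp.mapDomain, graft, PTree.bind]
  rw [key]
  refine InSymIdeal.comp_right (χ₁ := fun _ => c) (χ₂ := χ) ?_ ?_ ?_ hx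
  · refine ⟨fun a ha => absurd (Subsingleton.elim a 0) ha, hg.1,
      fun j hj => absurd (Subsingleton.elim j 0) hj, fun p => Or.inr (hg.2 p)⟩
  · exact ⟨fun j hj => absurd (Subsingleton.elim j 0) hj, fun l => congrFun hχ l⟩
  · refine Finsupp.single_mem_supported k _ ⟨trivial, rfl, by simp [leaves], fun l => ?_⟩
    simp [leaves, Subsingleton.elim l 0]

theorem inSymIdeal_element (ρ : Relator) :
    InSymIdeal symSignature (fun n χ c => {y | MLieRelation k n χ c y}) ρ.colouring ρ.colour
      ((ρ.element k).mapDomain toSym) := by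
  have hact := InSymIdeal.rel (S := symSignature)
    (R := fun n χ c => {y | MLieRelation k n χ c y}) MLieRelation.action
  -- The three action relators are one symmetric relation with permuted labels: `g` takes 0 and 1 to
  -- the Lie labels, in increasing order, and 2 to the module label.
  have key : ∀ (ρ : Relator) (g : Fin 3 → Fin 3), Function.Bijective g →
      ρ.colouring ∘ g = ![lie, lie, mod] → ρ.colour = mod → ρ.coeff k = 1 →
      toSym ρ.lead = (node .d (node .β (leaf 0) (leaf 1)) (leaf 2)).relabel g →
      toSym ρ.fst = (node .d (leaf 0) (node .d (leaf 1) (leaf 2))).relabel g →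
      toSym ρ.snd = (node .d (leaf 1) (node .d (leaf 0) (leaf 2))).relabel g →
      InSymIdeal symSignature (fun n χ c => {y | MLieRelation k n χ c y}) ρ.colouring ρ.colour
        ((ρ.element k).mapDomain toSym) := by
    intro ρ g hg hχ hc h1 h2 h3 h4
    have := hact.relabel hg hχ
    rw [hc]
    simpa [Relator.element, h1, Finsupp.mapDomain_add, sub_eq_add_neg, ← Finsupp.single_neg,
      Finsupp.mapDomain_single, h2, h3, h4] using this
  cases ρ with
  | jacobi =>
    have := InSymIdeal.rel (S := symSignature)
      (R := fun n χ c => {y | MLieRelation k n χ c y}) MLieRelation.jacobi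
    simpa [Relator.element, Relator.coeff, Relator.colouring, Relator.colour, Relator.lead,
      Relator.fst, Relator.snd, toSym, Finsupp.mapDomain_add, sub_eq_add_neg,
      ← Finsupp.single_neg, Finsupp.mapDomain_single] using this
  | actThird =>
    exact key .actThird ![0, 1, 2] (by decide) (by funext i; fin_cases i <;> rfl)
      rfl rfl rfl rfl rfl
  | actSecond =>
    exact key .actSecond ![0, 2, 1] (by decide) (by funext i; fin_cases i <;> rfl)
      rfl rfl rfl rfl rfl
  | actFirst =>
    exact key .actFirst ![1, 2, 0] (by decide) (by funext i; fin_cases i <;> rfl)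
      rfl rfl rfl rfl rfl

theorem mem_mlieIdeal_of_inShuffleIdeal {n : ℕ} {χ : Fin n → Colour} {c : Colour}
    {x : PTree ShGen (Fin n) →₀ k} (hx : InShuffleIdeal shSignature (relators k) χ c x) :
    x ∈ MLieIdeal k n χ c := by
  induction hx with
  | rel h =>
    obtain ⟨ρ⟩ := h
    exact ⟨ρ.element_mem_freeShuffle, inSymIdeal_element ρ⟩
  | zero χ c => exact ⟨Submodule.zero_mem _, by simpa using InSymIdeal.zero χ c⟩
  | add _ _ h1 h2 =>
    exact ⟨Submodule.add_mem _ h1.1 h2.1, by simpa [Finsupp.mapDomain_add] using h1.2.add h2.2⟩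
  | smul a _ h =>
    exact ⟨Submodule.smul_mem _ a h.1, by simpa [Finsupp.mapDomain_smul] using h.2.smul a⟩
  | comp_left h hχ _ hy h1 =>
    refine ⟨comp_mem_freeShuffle h hχ h1.1 hy, ?_⟩
    rw [mapDomain_toSym_comp]
    exact InSymIdeal.comp_left h.1 hχ h1.2 (mapDomain_toSym_mem_freeSym hy)
  | comp_right h hχ hx _ h1 =>
    refine ⟨comp_mem_freeShuffle h hχ hx h1.1, ?_⟩
    rw [mapDomain_toSym_comp]
    exact InSymIdeal.comp_right h.1 hχ (mapDomain_toSym_mem_freeSym hx) h1.2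

/-! ### Ideals on finite sets of labels -/

section IdealOn

variable {I Υ L : Type} [LinearOrder L] {k : Type*} [Field k]

theorem IsShuffleTreeOn.congr {S : Signature I Υ} {χ χ' : L → I} {c : I} {A : Finset L}
    {t : PTree Υ L} (h : IsShuffleTreeOn S χ c A t) (hχ : ∀ l ∈ A, χ l = χ' l) :
    IsShuffleTreeOn S χ' c A t := by
  have h1 : ∀ l ∈ t.leaves, ColouredOperad.rootColour S χ' (leaf l : PTree Υ L) = χ l :=
    fun l hl => (hχ l ((h.mem_leaves l).1 hl)).symm
  refine ⟨?_, ?_, h.nodup, h.mem_leaves, h.isShuffle⟩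
  · have := (wellColoured_bind (χ' := χ) t leaf h1).2 ⟨h.wellColoured, fun _ _ => trivial⟩
    rwa [bind_leaf] at this
  · have := rootColour_bind (χ' := χ) t leaf h1
    rwa [bind_leaf, h.rootColour] at this

/-- The ideal generated by `R`, transported to trees labelled by a finite set `A`. -/
def IdealOn (S : Signature I Υ) (R : Family k I Υ) (χ : L → I) (c : I) (A : Finset L)
    (x : PTree Υ L →₀ k) : Prop :=
  ∃ y, InShuffleIdeal S R (χ ∘ A.orderEmbOfFin rfl) c y ∧
    y.mapDomain (relabel (A.orderEmbOfFin rfl)) = x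

/-- A finite set has only one increasing enumeration, so any presentation of it may replace the
canonical one. -/
theorem idealOn_iff {S : Signature I Υ} {R : Family k I Υ} {χ : L → I} {c : I} {A : Finset L}
    {x : PTree Υ L →₀ k} {n : ℕ} {g : Fin n → L} (hg : StrictMono g)
    (hA : ∀ l, l ∈ A ↔ ∃ i, g i = l) :
    IdealOn S R χ c A x ↔
      ∃ y, InShuffleIdeal S R (χ ∘ g) c y ∧ y.mapDomain (relabel g) = x := by
  have h1 : A = Finset.univ.image g := by ext l; simp [hA]
  have h2 : A.card = n := by
    rw [h1, Finset.card_image_of_injective _ hg.injective, Finset.card_univ, Fintype.card_fin]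
  clear h1
  subst h2
  rw [Finset.orderEmbOfFin_unique rfl (fun i => (hA _).2 ⟨i, rfl⟩) hg]
  rfl

theorem idealOn_univ_iff {S : Signature I Υ} {R : Family k I Υ} {n : ℕ} {χ : Fin n → I} {c : I}
    {x : PTree Υ (Fin n) →₀ k} :
    IdealOn S R χ c Finset.univ x ↔ InShuffleIdeal S R χ c x := by
  rw [idealOn_iff (g := id) strictMono_id (by simp)]
  have : relabel (id : Fin n → Fin n) = (id : PTree Υ (Fin n) → _) :=
    funext fun t => relabel_eq_self t fun _ _ => rfl
  simp [this]

theorem exists_relabel_eq {S : Signature I Υ} {χ : L → I} {c : I} {A : Finset L} {t : PTree Υ L}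
    (h : IsShuffleTreeOn S χ c A t) :
    ∃ t', IsShuffleTree S (χ ∘ A.orderEmbOfFin rfl) c t' ∧
      t'.relabel (A.orderEmbOfFin rfl) = t := by
  have hA : ∀ l, l ∈ A ↔ ∃ i ∈ Finset.univ, A.orderEmbOfFin rfl i = l := by
    intro l
    rw [← Finset.mem_coe, ← Finset.range_orderEmbOfFin A rfl]
    simp only [Set.mem_range, Finset.mem_univ, true_and]
  have : Nonempty (Fin A.card) :=
    ⟨⟨0, Finset.card_pos.2 ⟨_, h.minLabel_mem⟩⟩⟩
  have ht : (t.relabel (Function.invFun (A.orderEmbOfFin rfl))).relabel (A.orderEmbOfFin rfl) = t := by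
    rw [relabel_relabel]
    refine relabel_eq_self t fun l hl => ?_
    obtain ⟨i, -, hi⟩ := (hA l).1 ((h.mem_leaves l).1 hl)
    exact Function.invFun_eq ⟨i, hi⟩
  refine ⟨_, isShuffleTree_iff.2 ?_, ht⟩
  rw [← isShuffleTreeOn_relabel (A.orderEmbOfFin rfl).strictMono hA, ht]
  exact h

/-- The tree `t` grafted on the leaf of `s` labelled `p`. -/
def graftAt (p : L) (s t : PTree Υ L) : PTree Υ L := s.bind fun l => if l = p then t else leaf l

theorem graftAt_of_notMem {p : L} {s t : PTree Υ L} (h : p ∉ s.leaves) : graftAt p s t = s := by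
  refine (bind_congr s fun l hl => ?_).trans s.bind_leaf
  exact if_neg fun e : l = p => h (e ▸ hl)

/-- Grafting a tree on a leaf is a shuffle composition, provided that the label of the leaf is the
smallest label of the tree. -/
theorem exists_shuffleComposition {A B C : Finset L} {p : L} (hpA : p ∈ A) (hpB : p ∈ B)
    (hmin : ∀ q ∈ B, p ≤ q) (hd : ∀ q ∈ A, q ≠ p → q ∉ B)
    (hC : ∀ q, q ∈ C ↔ (q ∈ A ∧ q ≠ p) ∨ q ∈ B) :
    ∃ (i : Fin A.card) (f : Fin A.card → Fin C.card) (g : Fin B.card → Fin C.card),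
      IsShuffleComposition i f g ∧ A.orderEmbOfFin rfl i = p ∧
      (∀ j, C.orderEmbOfFin rfl (f j) = A.orderEmbOfFin rfl j) ∧
      ∀ l, C.orderEmbOfFin rfl (g l) = B.orderEmbOfFin rfl l := by
  have hr : ∀ (A : Finset L) (q : L), q ∈ A → ∃ i, A.orderEmbOfFin rfl i = q := by
    intro A q hq
    rwa [← Finset.mem_coe, ← Finset.range_orderEmbOfFin A rfl] at hq
  have hAC : ∀ j, A.orderEmbOfFin rfl j ∈ C := fun j => by
    rw [hC]
    by_cases h : A.orderEmbOfFin rfl j = p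
    · exact Or.inr (h ▸ hpB)
    · exact Or.inl ⟨Finset.orderEmbOfFin_mem _ _ _, h⟩
  have hBC : ∀ j, B.orderEmbOfFin rfl j ∈ C := fun j =>
    (hC _).2 (Or.inr (Finset.orderEmbOfFin_mem _ _ _))
  choose f hf using fun j => hr C _ (hAC j)
  choose g hg using fun j => hr C _ (hBC j)
  obtain ⟨i, hi⟩ := hr A p hpA
  obtain ⟨l0, hl0⟩ := hr B p hpB
  have hf' : StrictMono f := fun a b h => by
    rw [← (C.orderEmbOfFin rfl).lt_iff_lt, hf, hf]
    exact (A.orderEmbOfFin rfl).strictMono h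
  have hg' : StrictMono g := fun a b h => by
    rw [← (C.orderEmbOfFin rfl).lt_iff_lt, hg, hg]
    exact (B.orderEmbOfFin rfl).strictMono h
  refine ⟨i, f, g, ⟨⟨hf'.injective.injOn, hg'.injective, ?_, ?_⟩, hf', hg', ⟨l0, ?_⟩, ?_⟩, hi, hf,
    hg⟩
  · intro j hj l e
    have h1 : A.orderEmbOfFin rfl j ≠ p := fun h =>
      hj ((A.orderEmbOfFin rfl).injective (h.trans hi.symm))
    refine hd _ (Finset.orderEmbOfFin_mem _ _ j) h1 ?_
    rw [← hf, e, hg]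
    exact Finset.orderEmbOfFin_mem _ _ _
  · intro q
    rcases (hC _).1 (Finset.orderEmbOfFin_mem C rfl q) with ⟨h1, h2⟩ | h
    · obtain ⟨j, hj⟩ := hr A _ h1
      refine Or.inl ⟨j, ?_, (C.orderEmbOfFin rfl).injective ((hf j).trans hj)⟩
      rintro rfl
      exact h2 (hj.symm.trans hi)
    · obtain ⟨l, hl⟩ := hr B _ h
      exact Or.inr ⟨l, (C.orderEmbOfFin rfl).injective ((hg l).trans hl)⟩
  · apply (C.orderEmbOfFin rfl).injective
    rw [hg, hf, hi, hl0]
  · rintro _ ⟨l, rfl⟩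
    rw [← (C.orderEmbOfFin rfl).le_iff_le, hg, hf, hi]
    exact hmin _ (Finset.orderEmbOfFin_mem _ _ _)

theorem relabel_graft {m n N : ℕ} {i : Fin m} {f : Fin m → Fin N} {g : Fin n → Fin N} {p : L}
    {eA : Fin m → L} {eB : Fin n → L} {eC : Fin N → L} (hi : ∀ j, eA j = p ↔ j = i)
    (hf : ∀ j, eC (f j) = eA j) (hg : ∀ l, eC (g l) = eB l) (s : PTree Υ (Fin m))
    (t : PTree Υ (Fin n)) :
    (graft i f g s t).relabel eC = graftAt p (s.relabel eA) (t.relabel eB) := by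
  rw [graft, relabel, bind_bind, graftAt, relabel.eq_1 eA, bind_bind]
  congr 1
  funext j
  by_cases hj : j = i
  · simp only [hj, if_true, PTree.bind, (hi i).2 rfl]
    exact (relabel_relabel g eC t).trans (congrArg (fun e => t.relabel e) (funext hg))
  · simp only [if_neg hj, PTree.bind, if_neg (mt (hi j).1 hj), hf]

variable {S : Signature I Υ} {R : Family k I Υ} {χ₁ χ : L → I} {c d : I} {A B C : Finset L} {p : L}

theorem isCompositeColouring_of_orderEmb {i : Fin A.card} {f : Fin A.card → Fin C.card}
    {g : Fin B.card → Fin C.card} (hi : A.orderEmbOfFin rfl i = p)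
    (hf : ∀ j, C.orderEmbOfFin rfl (f j) = A.orderEmbOfFin rfl j)
    (hg : ∀ l, C.orderEmbOfFin rfl (g l) = B.orderEmbOfFin rfl l)
    (hχ : ∀ q ∈ A, q ≠ p → χ₁ q = χ q) :
    IsCompositeColouring i f g (χ₁ ∘ A.orderEmbOfFin rfl) (χ ∘ B.orderEmbOfFin rfl)
      (χ ∘ C.orderEmbOfFin rfl) := by
  refine ⟨fun j hj => ?_, fun l => ?_⟩
  · rw [Function.comp, Function.comp, hf]
    exact (hχ _ (Finset.orderEmbOfFin_mem _ _ _) fun h =>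
      hj ((A.orderEmbOfFin rfl).injective (h.trans hi.symm))).symm
  · rw [Function.comp, Function.comp, hg]

/-- The label `p` plays two roles, as the leaf of `s` that is replaced and as the smallest label of
the grafted trees, and its colour may differ between them. Hence the separate colouring `χ₁`, which
agrees with `χ` away from `p`. -/
theorem IdealOn.graftAt_right (hpA : p ∈ A) (hpB : p ∈ B) (hmin : ∀ q ∈ B, p ≤ q)
    (hd : ∀ q ∈ A, q ≠ p → q ∉ B) (hC : ∀ q, q ∈ C ↔ (q ∈ A ∧ q ≠ p) ∨ q ∈ B)
    (hχ : ∀ q ∈ A, q ≠ p → χ₁ q = χ q) (hp : χ₁ p = d) {s : PTree Υ L} (hs : IsShuffleTreeOn S χ₁ c A s)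
    {y : PTree Υ L →₀ k} (hy : IdealOn S R χ d B y) :
    IdealOn S R χ c C (y.mapDomain (graftAt p s)) := by
  obtain ⟨i, f, g, h, hi, hf, hg⟩ := exists_shuffleComposition hpA hpB hmin hd hC
  obtain ⟨s, hs', rfl⟩ := exists_relabel_eq hs
  obtain ⟨y, hy, rfl⟩ := hy
  rw [← hp, ← hi] at hy
  refine ⟨_, InShuffleIdeal.comp_right h (isCompositeColouring_of_orderEmb hi hf hg hχ)
    (Finsupp.single_mem_supported k 1 hs') hy, ?_⟩
  have hi' : ∀ j, A.orderEmbOfFin rfl j = p ↔ j = i := fun j => by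
    rw [← hi, (A.orderEmbOfFin rfl).injective.eq_iff]
  have : comp i f g (Finsupp.single s 1) y = y.mapDomain (graft i f g s) := by
    rw [comp, Finsupp.sum_single_index (by simp)]
    simp [Finsupp.mapDomain]
  rw [this, ← Finsupp.mapDomain_comp, ← Finsupp.mapDomain_comp]
  congr 1
  funext t
  exact relabel_graft hi' hf hg s t

theorem IdealOn.graftAt_left (hpA : p ∈ A) (hpB : p ∈ B) (hmin : ∀ q ∈ B, p ≤ q)
    (hd : ∀ q ∈ A, q ≠ p → q ∉ B) (hC : ∀ q, q ∈ C ↔ (q ∈ A ∧ q ≠ p) ∨ q ∈ B)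
    (hχ : ∀ q ∈ A, q ≠ p → χ₁ q = χ q) (hp : χ₁ p = d) {x : PTree Υ L →₀ k} (hx : IdealOn S R χ₁ c A x)
    {t : PTree Υ L} (ht : IsShuffleTreeOn S χ d B t) :
    IdealOn S R χ c C (x.mapDomain fun s => graftAt p s t) := by
  obtain ⟨i, f, g, h, hi, hf, hg⟩ := exists_shuffleComposition hpA hpB hmin hd hC
  obtain ⟨t, ht', rfl⟩ := exists_relabel_eq ht
  obtain ⟨x, hx, rfl⟩ := hx
  rw [← hp, ← hi] at ht'
  refine ⟨_, InShuffleIdeal.comp_left h (isCompositeColouring_of_orderEmb hi hf hg hχ)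
    hx (Finsupp.single_mem_supported k 1 ht'), ?_⟩
  have hi' : ∀ j, A.orderEmbOfFin rfl j = p ↔ j = i := fun j => by
    rw [← hi, (A.orderEmbOfFin rfl).injective.eq_iff]
  have : comp i f g x (Finsupp.single t 1) = x.mapDomain (fun s => graft i f g s t) := by
    refine Finsupp.sum_congr fun s _ => ?_
    rw [Finsupp.sum_single_index (by simp), mul_one]
  rw [this, ← Finsupp.mapDomain_comp, ← Finsupp.mapDomain_comp]
  congr 1
  funext s
  exact relabel_graft hi' hf hg s t

/-- The family is obtained by grafting `x` on the leaf `p` of the tree `node a (leaf p) t`, in which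
`p`, the smallest label of `A`, stands for the whole left branch and temporarily takes its output
colour. -/
theorem IdealOn.node_left {a : Υ} {t : PTree Υ L} {x : PTree Υ L →₀ k}
    (hx : IdealOn S R χ (S.left a) A x) (ht : IsShuffleTreeOn S χ (S.right a) B t) (hpA : p ∈ A)
    (hmin : ∀ q ∈ A, p ≤ q) (hp : p < t.minLabel) (hd : Disjoint A B)
    (hC : ∀ q, q ∈ C ↔ q ∈ A ∨ q ∈ B) :
    IdealOn S R χ (S.out a) C (x.mapDomain fun s => node a s t) := by
  have hpB : p ∉ B := Finset.disjoint_left.1 hd hpA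
  have hne : ∀ q ∈ B, q ≠ p := fun q hq e => hpB (e ▸ hq)
  have ht' : IsShuffleTreeOn S (Function.update χ p (S.left a)) (S.right a) B t :=
    ht.congr fun q hq => by rw [Function.update_of_ne (hne q hq)]
  have hl := isShuffleTreeOn_leaf (S := S) (Function.update χ p (S.left a)) p
  rw [Function.update_self] at hl
  have hs : IsShuffleTreeOn S (Function.update χ p (S.left a)) (S.out a) (insert p B)
      (node a (leaf p) t) :=
    hl.node ht' hp (by simpa using hpB) (by simp)
  have := hx.graftAt_right (C := C) (χ₁ := Function.update χ p (S.left a)) (p := p)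
    (Finset.mem_insert_self _ _) hpA hmin ?_ ?_ ?_ (Function.update_self ..) hs
  · convert this using 2
    funext s
    have h := graftAt_of_notMem (t := s) (mt (ht.mem_leaves p).1 hpB)
    rw [graftAt] at h ⊢
    simp [PTree.bind, h]
  · intro q hq hqp hqA
    exact Finset.disjoint_left.1 hd hqA ((Finset.mem_insert.1 hq).resolve_left hqp)
  · intro q
    rw [hC, Finset.mem_insert, or_comm]
    refine or_congr_left ⟨fun h => ⟨Or.inr h, hne q h⟩, fun h => h.1.resolve_left h.2⟩
  · exact fun q _ hq => Function.update_of_ne hq _ _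

theorem IdealOn.node_right {a : Υ} {s : PTree Υ L} {x : PTree Υ L →₀ k}
    (hs : IsShuffleTreeOn S χ (S.left a) A s) (hx : IdealOn S R χ (S.right a) B x) (hpB : p ∈ B)
    (hmin : ∀ q ∈ B, p ≤ q) (hp : s.minLabel < p) (hd : Disjoint A B)
    (hC : ∀ q, q ∈ C ↔ q ∈ A ∨ q ∈ B) :
    IdealOn S R χ (S.out a) C (x.mapDomain fun t => node a s t) := by
  have hpA : p ∉ A := Finset.disjoint_right.1 hd hpB
  have hne : ∀ q ∈ A, q ≠ p := fun q hq e => hpA (e ▸ hq)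
  have hs' : IsShuffleTreeOn S (Function.update χ p (S.right a)) (S.left a) A s :=
    hs.congr fun q hq => by rw [Function.update_of_ne (hne q hq)]
  have hl := isShuffleTreeOn_leaf (S := S) (Function.update χ p (S.right a)) p
  rw [Function.update_self] at hl
  have ht : IsShuffleTreeOn S (Function.update χ p (S.right a)) (S.out a) (insert p A)
      (node a s (leaf p)) :=
    hs'.node hl hp (by simpa using hpA) (by simp [or_comm])
  have := hx.graftAt_right (C := C) (χ₁ := Function.update χ p (S.right a)) (p := p)
    (Finset.mem_insert_self _ _) hpB hmin ?_ ?_ ?_ (Function.update_self ..) ht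
  · convert this using 2
    funext t
    have h := graftAt_of_notMem (t := t) (mt (hs.mem_leaves p).1 hpA)
    rw [graftAt] at h ⊢
    simp [PTree.bind, h]
  · intro q hq hqp hqB
    exact Finset.disjoint_left.1 hd ((Finset.mem_insert.1 hq).resolve_left hqp) hqB
  · intro q
    rw [hC, Finset.mem_insert]
    refine or_congr_left ⟨fun h => ⟨Or.inr h, hne q h⟩, fun h => h.1.resolve_left h.2⟩
  · exact fun q _ hq => Function.update_of_ne hq _ _

/-- Simultaneous substitution into a relation is decomposed into three shuffle compositions. This is
how an instance of a relator with arbitrary branches is seen to lie in the ideal. -/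
theorem InShuffleIdeal.bind_three {χ' : Fin 3 → I} {x : PTree Υ (Fin 3) →₀ k}
    (hx : InShuffleIdeal S R χ' c x) {φ : Fin 3 → PTree Υ L} {B : Fin 3 → Finset L}
    (hφ : ∀ l, IsShuffleTreeOn S χ (χ' l) (B l) (φ l))
    (hm : StrictMono fun l => (φ l).minLabel) (hd : ∀ l l', l ≠ l' → Disjoint (B l) (B l'))
    (hC : ∀ q, q ∈ C ↔ ∃ l, q ∈ B l) :
    IdealOn S R χ c C (x.mapDomain fun t => t.bind φ) := by
  obtain ⟨m, hm'⟩ : ∃ m : Fin 3 → L, ∀ l, m l = (φ l).minLabel := ⟨_, fun _ => rfl⟩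
  have hm : StrictMono m := by rwa [show m = _ from funext hm']
  have hmB : ∀ l, m l ∈ B l := fun l => hm' l ▸ (hφ l).minLabel_mem
  have hle : ∀ l, ∀ q ∈ B l, m l ≤ q := fun l q hq =>
    hm' l ▸ minLabel_le _ (((hφ l).mem_leaves q).2 hq)
  have hnot : ∀ l l', l ≠ l' → m l ∉ B l' := fun l l' h => Finset.disjoint_left.1 (hd l l' h) (hmB l)
  have hne : ∀ {l l'}, l ≠ l' → m l ≠ m l' := fun h => hm.injective.ne h
  have h01 : m 0 ≠ m 1 := hne (by decide)
  have h02 : m 0 ≠ m 2 := hne (by decide)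
  have h12 : m 1 ≠ m 2 := hne (by decide)
  obtain ⟨χ1, e1⟩ : ∃ χ1, χ1 = Function.update χ (m 0) (χ' 0) := ⟨_, rfl⟩
  obtain ⟨χ2, e2⟩ : ∃ χ2, χ2 = Function.update χ1 (m 1) (χ' 1) := ⟨_, rfl⟩
  obtain ⟨χ3, e3⟩ : ∃ χ3, χ3 = Function.update χ2 (m 2) (χ' 2) := ⟨_, rfl⟩
  have a1 : ∀ q, q ≠ m 0 → χ1 q = χ q := fun q h => e1 ▸ Function.update_of_ne h _ _
  have a2 : ∀ q, q ≠ m 1 → χ2 q = χ1 q := fun q h => e2 ▸ Function.update_of_ne h _ _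
  have a3 : ∀ q, q ≠ m 2 → χ3 q = χ2 q := fun q h => e3 ▸ Function.update_of_ne h _ _
  have b1 : χ1 (m 0) = χ' 0 := e1 ▸ Function.update_self ..
  have b2 : χ2 (m 1) = χ' 1 := e2 ▸ Function.update_self ..
  have b3 : χ3 (m 2) = χ' 2 := e3 ▸ Function.update_self ..
  have hx3 : IdealOn S R χ3 c {m 0, m 1, m 2} (x.mapDomain (relabel m)) := by
    refine (idealOn_iff hm fun l => ?_).2 ⟨x, ?_, rfl⟩
    · simp [Fin.exists_fin_succ, eq_comm]
    · convert hx using 1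
      funext l
      fin_cases l
      · exact ((a3 _ h02).trans (a2 _ h01)).trans b1
      · exact (a3 _ h12).trans b2
      · exact b3
  have t2 : IsShuffleTreeOn S χ2 (χ' 2) (B 2) (φ 2) := (hφ 2).congr fun q hq => by
    rw [a2 q fun e => hnot 1 2 (by decide) (e ▸ hq), a1 q fun e => hnot 0 2 (by decide) (e ▸ hq)]
  have t1 : IsShuffleTreeOn S χ1 (χ' 1) (B 1) (φ 1) := (hφ 1).congr fun q hq => by
    rw [a1 q fun e => hnot 0 1 (by decide) (e ▸ hq)]
  have hx2 := hx3.graftAt_left (C := {m 0, m 1} ∪ B 2) (p := m 2) (by simp) (hmB 2) (hle 2)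
    (by
      have := hnot 0 2 (by decide); have := hnot 1 2 (by decide)
      simp; grind) (by simp; grind) (fun q _ hq => a3 q hq) b3 t2
  have hx1 := hx2.graftAt_left (C := {m 0} ∪ (B 1 ∪ B 2)) (p := m 1) (by simp) (hmB 1) (hle 1)
    (by
      have := hnot 0 1 (by decide); have := Finset.disjoint_left.1 (hd 1 2 (by decide))
      simp; grind) (by have := hnot 1 2 (by decide); simp; grind) (fun q _ hq => a2 q hq) b2 t1
  have hx0 := hx1.graftAt_left (C := C) (p := m 0) (by simp) (hmB 0) (hle 0)
    (by
      have := Finset.disjoint_left.1 (hd 0 1 (by decide))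
      have := Finset.disjoint_left.1 (hd 0 2 (by decide))
      simp; grind)
    (by
      have := hnot 0 1 (by decide); have := hnot 0 2 (by decide)
      simp [hC, Fin.exists_fin_succ]; grind) (fun q _ hq => a1 q hq) b1 (hφ 0)
  rw [← Finsupp.mapDomain_comp, ← Finsupp.mapDomain_comp, ← Finsupp.mapDomain_comp] at hx0
  convert hx0 using 2
  funext t
  simp only [Function.comp, graftAt, relabel, bind_bind]
  congr 1
  funext l
  fin_cases l
  · simp [PTree.bind, h01, h02]
  · have h := graftAt_of_notMem (t := φ 0) (mt ((hφ 1).mem_leaves _).1 (hnot 0 1 (by decide)))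
    rw [graftAt] at h
    simp [PTree.bind, h12, h]
  · have h := graftAt_of_notMem (t := φ 0) (mt ((hφ 2).mem_leaves _).1 (hnot 0 2 (by decide)))
    have h' := graftAt_of_notMem (t := φ 1) (mt ((hφ 2).mem_leaves _).1 (hnot 1 2 (by decide)))
    rw [graftAt] at h h'
    simp only [PTree.bind, Fin.reduceFinMk, if_true]
    rw [← bind_bind, h', h]

end IdealOn

/-! ### Reduction to normal trees -/

section Reduction

variable {L : Type} [LinearOrder L]

/-- Trees without divisors among the leading trees of the quadratic relations. -/
def IsNormal : PTree ShGen L → Prop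
  | .leaf _ => True
  | .node .β s t =>
      IsNormal s ∧ IsNormal t ∧ ∀ a u v, s = node a u v → t.minLabel < v.minLabel
  | .node .d s t => IsNormal s ∧ IsNormal t ∧ ∃ l, s = leaf l
  | .node .e s t => IsNormal s ∧ IsNormal t ∧ ∃ l, t = leaf l

theorem exists_eq_node_of_lie {M : Type} {χ : M → Colour} {t : PTree ShGen M}
    (h : rootColour shSignature χ t = lie) : (∃ l, t = leaf l) ∨ ∃ s u, t = node .β s u := by
  cases t with
  | leaf l => exact Or.inl ⟨l, rfl⟩
  | node a s u =>
    cases a with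
    | β => exact Or.inr ⟨s, u, rfl⟩
    | d => cases h
    | e => cases h

theorem strictMono_minLabel_three {t u v : PTree ShGen L} (h : t.minLabel < u.minLabel)
    (h' : u.minLabel < v.minLabel) : StrictMono fun l => (![t, u, v] l).minLabel := by
  rw [Fin.strictMono_iff_lt_succ]
  intro i
  fin_cases i
  · exact h
  · exact h'

/-- A tree that is not normal is divisible by a leading tree. -/
theorem exists_isBranch_of_not_isNormal {χ : L → Colour} {c : Colour} {A : Finset L}
    {t : PTree ShGen L} (ht : IsShuffleTreeOn shSignature χ c A t) (hn : ¬ IsNormal t) :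
    ∃ (ρ : Relator) (φ : Fin 3 → PTree ShGen L), (ρ.lead.bind φ).IsBranch t ∧
      StrictMono (fun l => (φ l).minLabel) ∧
      ∀ l, rootColour shSignature χ (φ l) = ρ.colouring l := by
  induction t generalizing c A with
  | leaf l => exact absurd trivial hn
  | node a s t hs ht' =>
    obtain ⟨h1, h2, h3, h4, -, -⟩ := ht.of_node
    by_cases hns : IsNormal s
    swap
    · obtain ⟨ρ, φ, b, h⟩ := hs h1 hns
      exact ⟨ρ, φ, b.left _ _ _, h⟩
    by_cases hnt : IsNormal t
    swap
    · obtain ⟨ρ, φ, b, h⟩ := ht' h2 hnt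
      exact ⟨ρ, φ, b.right _ _ _, h⟩
    have split : ∀ l : Fin 3, l = 0 ∨ l = 1 ∨ l = 2 := by decide
    cases a with
    | β =>
      simp only [IsNormal, hns, hnt, true_and, not_forall, not_lt] at hn
      obtain ⟨a, u, v, rfl, hle⟩ := hn
      obtain ⟨_, _, h⟩ := (exists_eq_node_of_lie h1.rootColour).resolve_left (by simp)
      obtain ⟨rfl, -, -⟩ := PTree.node.inj h
      obtain ⟨g1, g2, g3, g4, -, -⟩ := h1.of_node
      -- The branches have disjoint labels, so the failure of normality is a strict inequality, and
      -- the three branches are in increasing order of their smallest labels.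
      have hne : v.minLabel ≠ t.minLabel := fun e =>
        Finset.disjoint_left.1 h4 (show v.minLabel ∈ _ by simp [leaves, minLabel_mem])
          (by simp [e, minLabel_mem])
      refine ⟨.jacobi, ![u, v, t], .refl,
        strictMono_minLabel_three g3 (lt_of_le_of_ne hle hne), fun l => ?_⟩
      rcases split l with rfl | rfl | rfl
      exacts [g1.rootColour, g2.rootColour, h2.rootColour]
    | d =>
      simp only [IsNormal, hns, hnt, true_and] at hn
      obtain ⟨u, v, rfl⟩ := (exists_eq_node_of_lie h1.rootColour).resolve_left hn
      obtain ⟨g1, g2, g3, g4, -, -⟩ := h1.of_node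
      have hne : v.minLabel ≠ t.minLabel := fun e =>
        Finset.disjoint_left.1 h4 (show v.minLabel ∈ _ by simp [leaves, minLabel_mem])
          (by simp [e, minLabel_mem])
      -- The shuffle condition leaves open whether the module branch comes after or before the
      -- second argument of the bracket. These are the two action relators with root `d`.
      rcases lt_or_gt_of_ne hne with hlt | hlt
      · refine ⟨.actThird, ![u, v, t], .refl, strictMono_minLabel_three g3 hlt, fun l => ?_⟩
        rcases split l with rfl | rfl | rfl
        exacts [g1.rootColour, g2.rootColour, h2.rootColour]
      · refine ⟨.actSecond, ![u, t, v], .refl, strictMono_minLabel_three ?_ hlt, fun l => ?_⟩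
        · simpa [minLabel, g3.le] using h3
        · rcases split l with rfl | rfl | rfl
          exacts [g1.rootColour, h2.rootColour, g2.rootColour]
    | e =>
      simp only [IsNormal, hns, hnt, true_and] at hn
      obtain ⟨u, v, rfl⟩ := (exists_eq_node_of_lie h2.rootColour).resolve_left hn
      obtain ⟨g1, g2, g3, g4, -, -⟩ := h2.of_node
      refine ⟨.actFirst, ![s, u, v], .refl,
        strictMono_minLabel_three (h3.trans_le (min_le_left _ _)) g3, fun l => ?_⟩
      rcases split l with rfl | rfl | rfl
      exacts [h1.rootColour, g1.rootColour, g2.rootColour]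

/-! ### Compatibility of the path comparison with tree contexts and substitution. -/

theorem pathMonomial_node_left {w : ShGen → QMonomial} {a : ShGen} {s t : PTree ShGen L} {q : L}
    (h : q ∈ s.leaves) : pathMonomial w q (node a s t) = w a * pathMonomial w q s := by
  simp [pathMonomial, h]

theorem pathMonomial_node_right {w : ShGen → QMonomial} {a : ShGen} {s t : PTree ShGen L} {q : L}
    (h : q ∉ s.leaves) : pathMonomial w q (node a s t) = w a * pathMonomial w q t := by
  simp [pathMonomial, h]

theorem PathLT.node_left {a : ShGen} {A B C : Finset L} {u s t : PTree ShGen L}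
    (h : PathLT A u s) (hu : ∀ l, l ∈ u.leaves ↔ l ∈ A) (hs : ∀ l, l ∈ s.leaves ↔ l ∈ A)
    (hC : ∀ q, q ∈ C ↔ q ∈ A ∨ q ∈ B) : PathLT C (node a u t) (node a s t) := by
  obtain ⟨p, hp, hlt, heq⟩ := h
  refine ⟨p, (hC p).2 (Or.inl hp), ?_, fun q hq hqp => ?_⟩
  · rw [pathMonomial_node_left ((hu p).2 hp), pathMonomial_node_left ((hs p).2 hp)]
    exact mul_lt_mul_right hlt _
  · by_cases hqA : q ∈ A
    · rw [pathMonomial_node_left ((hu q).2 hqA), pathMonomial_node_left ((hs q).2 hqA),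
        heq q hqA hqp]
    · rw [pathMonomial_node_right (mt (hu q).1 hqA), pathMonomial_node_right (mt (hs q).1 hqA)]

theorem PathLT.node_right {a : ShGen} {A B C : Finset L} {s u t : PTree ShGen L}
    (h : PathLT B u t) (hs : ∀ l, l ∈ s.leaves ↔ l ∈ A) (hd : Disjoint A B)
    (hC : ∀ q, q ∈ C ↔ q ∈ A ∨ q ∈ B) : PathLT C (node a s u) (node a s t) := by
  obtain ⟨p, hp, hlt, heq⟩ := h
  have hpA := Finset.disjoint_right.1 hd hp
  refine ⟨p, (hC p).2 (Or.inr hp), ?_, fun q hq hqp => ?_⟩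
  · rw [pathMonomial_node_right (mt (hs p).1 hpA), pathMonomial_node_right (mt (hs p).1 hpA)]
    exact mul_lt_mul_right hlt _
  · by_cases hqA : q ∈ A
    · rw [pathMonomial_node_left ((hs q).2 hqA), pathMonomial_node_left ((hs q).2 hqA)]
    · rw [pathMonomial_node_right (mt (hs q).1 hqA), pathMonomial_node_right (mt (hs q).1 hqA),
        heq q (((hC q).1 hq).resolve_left hqA) hqp]

/-- The first difference moves from the leaf `p` to the smallest label of `φ p`. A smaller label
lies in some `φ l` with `l < p`, where the prefactors agree. -/
theorem PathLT.bind {n : ℕ} {χ χ' : Fin n → Colour} {c c' : Colour} {u t : PTree ShGen (Fin n)}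
    (h : PathLT Finset.univ u t) (hu : IsShuffleTree shSignature χ c u)
    (ht : IsShuffleTree shSignature χ' c' t) {φ : Fin n → PTree ShGen L} {B : Fin n → Finset L}
    {C : Finset L} (hφ : ∀ l q, q ∈ (φ l).leaves ↔ q ∈ B l)
    (hm : StrictMono fun l => (φ l).minLabel) (hd : ∀ l l', l ≠ l' → Disjoint (B l) (B l'))
    (hC : ∀ q, q ∈ C ↔ ∃ l, q ∈ B l) : PathLT C (u.bind φ) (t.bind φ) := by
  have key : ∀ {χ : Fin n → Colour} {c : Colour} {t : PTree ShGen (Fin n)},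
      IsShuffleTree shSignature χ c t → ∀ l, ∀ q ∈ (φ l).leaves,
      pathMonomial mlieWeight q (t.bind φ) =
        pathMonomial mlieWeight l t * pathMonomial mlieWeight q (φ l) := by
    intro χ c t ht l q hq
    simp only [pathMonomial_eq_pathProd]
    refine pathProd_bind _ ht.1.2.2.1 (ht.1.2.2.2 l) hq fun l' _ hne hq' => ?_
    exact Finset.disjoint_left.1 (hd l' l hne) ((hφ _ _).1 hq') ((hφ _ _).1 hq)
  obtain ⟨p, -, hlt, heq⟩ := h
  refine ⟨(φ p).minLabel, (hC _).2 ⟨p, (hφ _ _).1 (minLabel_mem _)⟩, ?_, fun q hq hqp => ?_⟩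
  · rw [key hu p _ (minLabel_mem _), key ht p _ (minLabel_mem _)]
    exact mul_lt_mul_left hlt _
  · obtain ⟨l, hl⟩ := (hC q).1 hq
    rw [← hφ] at hl
    rw [key hu l q hl, key ht l q hl, heq l (Finset.mem_univ _)
      (hm.lt_iff_lt.1 ((minLabel_le _ hl).trans_lt hqp))]

variable {k : Type*} [Field k]

/-- Modulo the quadratic relations, `t` is a combination of smaller trees. -/
def Reducible (k : Type*) [Field k] (χ : L → Colour) (c : Colour) (A : Finset L)
    (t : PTree ShGen L) : Prop :=
  ∃ y : PTree ShGen L →₀ k,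
    (∀ u ∈ y.support, IsShuffleTreeOn shSignature χ c A u ∧ PathLT A u t) ∧
    IdealOn shSignature (relators k) χ c A (.single t 1 - y)

/-- Substituting the branches `φ` into the relator `ρ` expresses the instance of its leading tree
through instances of its two lower trees. -/
theorem reducible_lead_bind (ρ : Relator) {χ : L → Colour} {φ : Fin 3 → PTree ShGen L}
    {B : Fin 3 → Finset L} {C : Finset L}
    (hφ : ∀ l, IsShuffleTreeOn shSignature χ (ρ.colouring l) (B l) (φ l))
    (hm : StrictMono fun l => (φ l).minLabel) (hd : ∀ l l', l ≠ l' → Disjoint (B l) (B l'))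
    (hC : ∀ q, q ∈ C ↔ ∃ l, q ∈ B l) : Reducible k χ ρ.colour C (ρ.lead.bind φ) := by
  classical
  have hbind : ∀ {t}, IsShuffleTree shSignature ρ.colouring ρ.colour t →
      IsShuffleTreeOn shSignature χ ρ.colour C (t.bind φ) := fun ht =>
    (isShuffleTree_iff.1 ht).bind (B := B) (fun l _ => hφ l) (hm.strictMonoOn _)
      (fun l _ l' _ => hd l l') (by simpa using hC)
  refine ⟨.single (ρ.fst.bind φ) 1 - ρ.coeff k • .single (ρ.snd.bind φ) 1, fun u hu => ?_, ?_⟩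
  · have : u = ρ.fst.bind φ ∨ u = ρ.snd.bind φ := by
      by_contra! h
      simp [h.1.symm, h.2.symm] at hu
    rcases this with rfl | rfl
    · exact ⟨hbind ρ.isShuffleTree_fst, ρ.pathLT_fst.bind ρ.isShuffleTree_fst
        ρ.isShuffleTree_lead (fun l => (hφ l).mem_leaves) hm hd hC⟩
    · exact ⟨hbind ρ.isShuffleTree_snd, ρ.pathLT_snd.bind ρ.isShuffleTree_snd
        ρ.isShuffleTree_lead (fun l => (hφ l).mem_leaves) hm hd hC⟩
  · have h : InShuffleIdeal shSignature (relators k) ρ.colouring ρ.colour (ρ.element k) :=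
      .rel ⟨ρ⟩
    convert h.bind_three hφ hm hd hC using 1
    simp only [Relator.element, sub_eq_add_neg, ← Finsupp.single_neg, Finsupp.mapDomain_add,
      Finsupp.mapDomain_smul, Finsupp.mapDomain_single, neg_add, neg_neg]
    abel

/-- A reduction may be carried out inside a branch: the replacing trees have the same labels, hence
the same smallest label, so the shuffle condition at the root survives. -/
theorem Reducible.node_left {χ : L → Colour} {c : Colour} {a : ShGen} {A : Finset L}
    {s t : PTree ShGen L} (h : IsShuffleTreeOn shSignature χ c A (node a s t))
    (hs : Reducible k χ (shSignature.left a) s.leaves.toFinset s) :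
    Reducible k χ c A (node a s t) := by
  classical
  obtain ⟨h1, h2, h3, h4, rfl, h6⟩ := h.of_node
  obtain ⟨y, hy, hI⟩ := hs
  have hmin : ∀ {u}, IsShuffleTreeOn shSignature χ (shSignature.left a) s.leaves.toFinset u →
      u.minLabel = s.minLabel := fun hu =>
    minLabel_eq _ ((hu.mem_leaves _).2 h1.minLabel_mem) fun l hl =>
      minLabel_le _ ((h1.mem_leaves l).2 ((hu.mem_leaves l).1 hl))
  refine ⟨y.mapDomain fun u => node a u t, fun u hu => ?_, ?_⟩
  · obtain ⟨v, hv, rfl⟩ := Finset.mem_image.1 (Finsupp.mapDomain_support hu)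
    obtain ⟨hv1, hv2⟩ := hy v hv
    exact ⟨hv1.node h2 (by rwa [hmin hv1]) h4 h6,
      hv2.node_left hv1.mem_leaves h1.mem_leaves h6⟩
  · convert hI.node_left h2 h1.minLabel_mem
      (fun q hq => minLabel_le _ ((h1.mem_leaves q).2 hq)) h3 h4 h6 using 1
    simp only [sub_eq_add_neg, ← Finsupp.mapDomain.addMonoidHom_apply, map_add, map_neg]
    simp

theorem Reducible.node_right {χ : L → Colour} {c : Colour} {a : ShGen} {A : Finset L}
    {s t : PTree ShGen L} (h : IsShuffleTreeOn shSignature χ c A (node a s t))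
    (ht : Reducible k χ (shSignature.right a) t.leaves.toFinset t) :
    Reducible k χ c A (node a s t) := by
  classical
  obtain ⟨h1, h2, h3, h4, rfl, h6⟩ := h.of_node
  obtain ⟨y, hy, hI⟩ := ht
  have hmin : ∀ {u}, IsShuffleTreeOn shSignature χ (shSignature.right a) t.leaves.toFinset u →
      u.minLabel = t.minLabel := fun hu =>
    minLabel_eq _ ((hu.mem_leaves _).2 h2.minLabel_mem) fun l hl =>
      minLabel_le _ ((h2.mem_leaves l).2 ((hu.mem_leaves l).1 hl))
  refine ⟨y.mapDomain fun u => node a s u, fun u hu => ?_, ?_⟩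
  · obtain ⟨v, hv, rfl⟩ := Finset.mem_image.1 (Finsupp.mapDomain_support hu)
    obtain ⟨hv1, hv2⟩ := hy v hv
    exact ⟨h1.node hv1 (by rwa [hmin hv1]) h4 h6, hv2.node_right h1.mem_leaves h4 h6⟩
  · convert hI.node_right h1 h2.minLabel_mem
      (fun q hq => minLabel_le _ ((h2.mem_leaves q).2 hq)) h3 h4 h6 using 1
    simp only [sub_eq_add_neg, ← Finsupp.mapDomain.addMonoidHom_apply, map_add, map_neg]
    simp

theorem Reducible.of_isBranch {χ : L → Colour} {b t : PTree ShGen L} (hb : b.IsBranch t)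
    {c : Colour} {A : Finset L} (ht : IsShuffleTreeOn shSignature χ c A t)
    (h : IsShuffleTreeOn shSignature χ (rootColour shSignature χ b) b.leaves.toFinset b →
      Reducible k χ (rootColour shSignature χ b) b.leaves.toFinset b) :
    Reducible k χ c A t := by
  induction hb generalizing c A with
  | refl =>
    have e : b.leaves.toFinset = A := by ext l; simp [ht.mem_leaves]
    rw [ht.rootColour, e] at h
    exact h ht
  | left a t u _ ih => exact .node_left ht (ih ht.of_node.1)
  | right a t u _ ih => exact .node_right ht (ih ht.of_node.2.1)

/-- A tree that is not normal is reducible. -/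
theorem reducible_of_not_isNormal {χ : L → Colour} {c : Colour} {A : Finset L}
    {t : PTree ShGen L} (ht : IsShuffleTreeOn shSignature χ c A t) (hn : ¬ IsNormal t) :
    Reducible k χ c A t := by
  obtain ⟨ρ, φ, hb, hm, hc⟩ := exists_isBranch_of_not_isNormal ht hn
  refine .of_isBranch hb ht fun h => ?_
  have hl := ρ.isShuffleTree_lead
  have hmem : ∀ l, l ∈ ρ.lead.leaves := hl.1.2.2.2
  rw [rootColour_bind (χ' := ρ.colouring) _ _ fun l _ => hc l, hl.1.2.1]
  have h1 := ((wellColoured_bind (χ' := ρ.colouring) _ _ fun l _ => hc l).1 h.wellColoured).2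
  have h2 := ((isShuffle_bind _ _ (hm.strictMonoOn _)).1 h.isShuffle).2
  have h3 := h.nodup
  rw [leaves_bind, List.nodup_flatMap] at h3
  refine reducible_lead_bind ρ (B := fun l => (φ l).leaves.toFinset)
    (fun l => ⟨h1 l (hmem l), hc l, h3.1 l (hmem l), by simp, h2 l (hmem l)⟩) hm ?_ ?_
  · intro l l' hne
    have : Std.Symm (Function.onFun List.Disjoint fun l => (φ l).leaves) :=
      ⟨fun _ _ h => h.symm⟩
    have := h3.2.forall (hmem l) (hmem l') hne
    rw [Finset.disjoint_left]
    exact fun q hq hq' => this (by simpa using hq) (by simpa using hq')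
  · intro q
    simp [leaves_bind, hmem]

end Reduction

/-! ### Evaluation in associative algebras -/

section Evaluation

variable {k : Type*} [Field k] {A : Type*} [Ring A] {L M : Type}

/-- The value of a tree in an associative algebra, where `β` is the commutator and `d` is the
product. -/
def evalTree (a : L → A) : PTree SymGen L → A
  | .leaf l => a l
  | .node .β s t => evalTree a s * evalTree a t - evalTree a t * evalTree a s
  | .node .d s t => evalTree a s * evalTree a t

theorem evalTree_bind (a : M → A) (t : PTree SymGen L) (φ : L → PTree SymGen M) :
    evalTree a (t.bind φ) = evalTree (fun l => evalTree a (φ l)) t := by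
  induction t with
  | leaf l => rfl
  | node b s t hs ht => cases b <;> simp only [PTree.bind, evalTree, hs, ht]

theorem evalTree_congr {a a' : L → A} {t : PTree SymGen L} (h : ∀ l ∈ t.leaves, a l = a' l) :
    evalTree a t = evalTree a' t := by
  induction t with
  | leaf l => exact h l (by simp [leaves])
  | node b s t hs ht =>
    simp only [leaves, List.mem_append] at h
    have h1 := hs fun l hl => h l (Or.inl hl)
    have h2 := ht fun l hl => h l (Or.inr hl)
    cases b <;> simp only [evalTree, h1, h2]

variable [Algebra k A]

/-- Each label occurs once, and both the product and the commutator are bilinear. -/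
theorem exists_linearMap_evalTree [DecidableEq L] (a : L → A) {i : L} {t : PTree SymGen L}
    (ht : t.leaves.Nodup) (hi : i ∈ t.leaves) :
    ∃ Λ : A →ₗ[k] A, ∀ z, evalTree (Function.update a i z) t = Λ z := by
  have hconst : ∀ {s : PTree SymGen L} (z : A), i ∉ s.leaves →
      evalTree (Function.update a i z) s = evalTree a s := fun z hs =>
    evalTree_congr fun l hl => Function.update_of_ne (by rintro rfl; exact hs hl) _ _
  induction t with
  | leaf l =>
    obtain rfl : i = l := by simpa [leaves] using hi
    exact ⟨LinearMap.id, fun z => by simp [evalTree]⟩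
  | node b s t hs ht' =>
    rw [leaves, List.nodup_append'] at ht
    by_cases his : i ∈ s.leaves
    · obtain ⟨Λ, h⟩ := hs ht.1 his
      have hc := fun z => hconst z (ht.2.2 his)
      cases b
      · exact ⟨(LinearMap.mulRight k (evalTree a t) - LinearMap.mulLeft k (evalTree a t)) ∘ₗ Λ,
          fun z => by simp [evalTree, h, hc]⟩
      · exact ⟨LinearMap.mulRight k (evalTree a t) ∘ₗ Λ, fun z => by simp [evalTree, h, hc]⟩
    · obtain ⟨Λ, h⟩ := ht' ht.2.1 ((List.mem_append.1 hi).resolve_left his)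
      have hc := fun z => hconst z his
      cases b
      · exact ⟨(LinearMap.mulLeft k (evalTree a s) - LinearMap.mulRight k (evalTree a s)) ∘ₗ Λ,
          fun z => by simp [evalTree, h, hc]⟩
      · exact ⟨LinearMap.mulLeft k (evalTree a s) ∘ₗ Λ, fun z => by simp [evalTree, h, hc]⟩

theorem evalTree_graft {m n N : ℕ} (i : Fin m) (f : Fin m → Fin N) (g : Fin n → Fin N)
    (a : Fin N → A) (s : PTree SymGen (Fin m)) (t : PTree SymGen (Fin n)) :
    evalTree a (graft i f g s t) =
      evalTree (Function.update (a ∘ f) i (evalTree (a ∘ g) t)) s := by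
  rw [graft, evalTree_bind]
  congr 1
  funext j
  by_cases hj : j = i
  · subst hj
    simp only [if_true, Function.update_self, PTree.relabel, evalTree_bind]
    rfl
  · simp only [if_neg hj, Function.update_of_ne hj]
    rfl

theorem linearCombination_evalTree_comp {m n N : ℕ} (i : Fin m) (f : Fin m → Fin N)
    (g : Fin n → Fin N) (a : Fin N → A) (x : PTree SymGen (Fin m) →₀ k)
    (y : PTree SymGen (Fin n) →₀ k) :
    Finsupp.linearCombination k (evalTree a) (comp i f g x y) =
      x.sum fun s α => y.sum fun t β =>
        (α * β) • evalTree (Function.update (a ∘ f) i (evalTree (a ∘ g) t)) s := by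
  rw [comp, Finsupp.sum, map_sum]
  refine Finset.sum_congr rfl fun s _ => ?_
  rw [Finsupp.sum, map_sum]
  refine Finset.sum_congr rfl fun t _ => ?_
  rw [Finsupp.linearCombination_single, evalTree_graft]

/-- The relations of the operad of a Lie algebra with a module vanish in associative algebras. -/
theorem linearCombination_evalTree_eq_zero {n : ℕ} {χ : Fin n → Colour} {c : Colour}
    {x : PTree SymGen (Fin n) →₀ k}
    (hx : InSymIdeal symSignature (fun n χ c => {y | MLieRelation k n χ c y}) χ c x)
    (a : Fin n → A) : Finsupp.linearCombination k (evalTree a) x = 0 := by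
  induction hx with
  | rel h =>
    -- For the action the identity is [a,b]c = a(bc) − b(ac); the other two are antisymmetry and the
    -- Jacobi identity for the commutator.
    cases h <;>
      simp only [map_add, map_sub, Finsupp.linearCombination_single, one_smul, evalTree] <;>
      noncomm_ring
  | zero => simp
  | add _ _ h1 h2 => rw [map_add, h1, h2, add_zero]
  | smul b _ h => rw [map_smul, h, smul_zero]
  | @comp_left m _ _ i f g _ _ _ _ x y _ _ _ _ ih =>
    -- For each fixed inner tree the relation in the outer trees is evaluated with the value of the
    -- inner tree at the leaf `i`.
    rw [linearCombination_evalTree_comp, Finsupp.sum_comm]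
    refine Finset.sum_eq_zero fun t _ => ?_
    have := congrArg (y t • ·) (ih (Function.update (a ∘ f) i (evalTree (a ∘ g) t)))
    simp only [Finsupp.linearCombination_apply, Finsupp.sum, Finset.smul_sum, smul_zero,
      smul_smul, mul_comm (y t)] at this
    exact this
  | @comp_right m _ _ i f g _ _ _ _ x y _ _ hx _ ih =>
    rw [linearCombination_evalTree_comp]
    refine Finset.sum_eq_zero fun s hs => ?_
    have hs : IsColouredTree symSignature _ _ s := hx hs
    -- The value of a fixed outer tree depends linearly on the element at `i`, so the vanishing of
    -- the inner relation carries over.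
    obtain ⟨Λ, hΛ⟩ := exists_linearMap_evalTree (k := k) (a ∘ f) hs.2.2.1 (hs.2.2.2 i)
    simp only [hΛ, mul_smul]
    rw [Finsupp.sum, ← Finset.smul_sum]
    have := congrArg Λ (ih (a ∘ g))
    rw [Finsupp.linearCombination_apply, Finsupp.sum, map_sum, map_zero] at this
    simp only [map_smul] at this
    rw [this, smul_zero]

end Evaluation

/-! ### Leading words -/

section Words

variable {k : Type*} [Field k] {L : Type}

/-- A word as an element of the free associative algebra. -/
def word (k : Type*) [Field k] (w : List L) : MonoidAlgebra k (FreeMonoid L) :=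
  .single (FreeMonoid.ofList w) 1

theorem word_mul_word (w v : List L) : word k w * word k v = word k (w ++ v) := by
  rw [word, word, MonoidAlgebra.single_mul_single, mul_one]; rfl

/-- The span of the words with the property `P`. -/
def wordSpan (k : Type*) [Field k] (P : List L → Prop) : Submodule k (MonoidAlgebra k (FreeMonoid L)) :=
  Submodule.span k (word k '' {w | P w})

theorem word_mem_wordSpan {P : List L → Prop} {w : List L} (h : P w) : word k w ∈ wordSpan k P :=
  Submodule.subset_span ⟨w, h, rfl⟩

theorem wordSpan_mono {P Q : List L → Prop} (h : ∀ w, P w → Q w) : wordSpan k P ≤ wordSpan k Q :=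
  Submodule.span_mono (Set.image_mono h)

theorem mul_mem_wordSpan {P Q R : List L → Prop} (h : ∀ u v, P u → Q v → R (u ++ v))
    {p q : MonoidAlgebra k (FreeMonoid L)} (hp : p ∈ wordSpan k P) (hq : q ∈ wordSpan k Q) :
    p * q ∈ wordSpan k R := by
  have := Submodule.mul_mem_mul hp hq
  rw [wordSpan, wordSpan, Submodule.span_mul_span] at this
  refine Submodule.span_mono ?_ this
  rintro _ ⟨_, ⟨u, hu, rfl⟩, _, ⟨v, hv, rfl⟩, rfl⟩
  exact ⟨u ++ v, h u v hu hv, (word_mul_word u v).symm⟩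

theorem coeff_eq_zero_of_mem_wordSpan {P : List L → Prop} {p : MonoidAlgebra k (FreeMonoid L)}
    (hp : p ∈ wordSpan k P) {w : List L} (hw : ¬ P w) : p.coeff (FreeMonoid.ofList w) = 0 := by
  classical
  induction hp using Submodule.span_induction with
  | mem x h =>
    obtain ⟨v, hv, rfl⟩ := h
    rw [word, MonoidAlgebra.coeff_single, Finsupp.single_apply, if_neg]
    intro e
    exact hw (FreeMonoid.ofList.injective e ▸ hv)
  | zero => rfl
  | add x y _ _ hx hy => simp [hx, hy]
  | smul a x _ hx => simp [hx]

theorem append_lt_append_of_length_eq [LinearOrder L] {u u' v v' : List L}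
    (hl : u'.length = u.length) (h : u < u') : u ++ v < u' ++ v' := by
  induction u generalizing u' with
  | nil =>
    rw [List.eq_nil_of_length_eq_zero hl] at h
    exact absurd h (lt_irrefl _)
  | cons x u ih =>
    cases u' with
    | nil => simp at hl
    | cons x' u' =>
      rw [List.cons_lt_cons_iff] at h
      rw [List.cons_append, List.cons_append, List.cons_lt_cons_iff]
      exact h.imp_right fun h => ⟨h.1, ih (by simpa using hl) h.2⟩

variable [LinearOrder L]

/-- The least word of `p` is `w`, with coefficient `1`, and all words of `p` have the same
length. -/
def HasLeastWord (p : MonoidAlgebra k (FreeMonoid L)) (w : List L) : Prop :=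
  p - word k w ∈ wordSpan k fun u => u.length = w.length ∧ w < u

theorem HasLeastWord.mem_wordSpan {p : MonoidAlgebra k (FreeMonoid L)} {w : List L}
    (h : HasLeastWord p w) : p ∈ wordSpan k fun u => u.length = w.length ∧ w ≤ u := by
  rw [← sub_add_cancel p (word k w)]
  exact add_mem (wordSpan_mono (fun u hu => ⟨hu.1, hu.2.le⟩) h) (word_mem_wordSpan ⟨rfl, le_rfl⟩)

/-- Lexicographic comparison is compatible with concatenation on the left always, and on the right
for words of equal length. This is why equal length is part of the definition. -/
theorem HasLeastWord.mul {p q : MonoidAlgebra k (FreeMonoid L)} {w v : List L}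
    (hp : HasLeastWord p w) (hq : HasLeastWord q v) : HasLeastWord (p * q) (w ++ v) := by
  have e : p * q - word k (w ++ v) = word k w * (q - word k v) + (p - word k w) * q := by
    rw [← word_mul_word]; noncomm_ring
  rw [HasLeastWord, e]
  refine add_mem ?_ ?_
  · refine mul_mem_wordSpan (P := fun u => u = w) ?_ (word_mem_wordSpan rfl) hq
    rintro u u' rfl ⟨h1, h2⟩
    exact ⟨by simp [h1], List.append_left_lt h2⟩
  · refine mul_mem_wordSpan ?_ hp hq.mem_wordSpan
    rintro u u' ⟨h1, h2⟩ ⟨h3, -⟩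
    exact ⟨by simp [h1, h3], append_lt_append_of_length_eq h1 h2⟩

/-- All words of `q * p` begin with a letter that is at least `y`, hence exceed the least word of `p
* q`, which begins with `x`. The subtracted product cannot affect the least word. -/
theorem HasLeastWord.commutator {p q : MonoidAlgebra k (FreeMonoid L)} {w v : List L} {x y : L}
    (hp : HasLeastWord p (x :: w)) (hq : HasLeastWord q (y :: v)) (h : x < y) :
    HasLeastWord (p * q - q * p) ((x :: w) ++ (y :: v)) := by
  rw [HasLeastWord, sub_right_comm]
  refine sub_mem (hp.mul hq) (mul_mem_wordSpan ?_ hq.mem_wordSpan hp.mem_wordSpan)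
  rintro u u' ⟨h1, h2⟩ ⟨h3, -⟩
  refine ⟨by simp only [List.length_append, h1, h3]; exact add_comm _ _, ?_⟩
  cases u with
  | nil => simp at h1
  | cons z u =>
    rw [List.cons_append, List.cons_append, List.cons_lt_cons_iff]
    refine Or.inl (h.trans_le ?_)
    rcases h2.lt_or_eq with h2 | h2
    · exact (List.cons_lt_cons_iff.1 h2).elim le_of_lt fun h => h.1.le
    · exact (List.cons.inj h2).1.le

/-- A tree with Lie output is made of brackets only, so `toSym` does not swap branches, and the
shuffle condition puts the smallest label leftmost. -/
theorem leaves_toSym_of_lie {χ : L → Colour} {t : PTree ShGen L}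
    (hc : WellColoured shSignature χ t) (hr : rootColour shSignature χ t = lie)
    (hs : t.IsShuffle) : ∃ w, (toSym t).leaves = t.minLabel :: w := by
  induction t with
  | leaf l => exact ⟨[], rfl⟩
  | node a s t ihs iht =>
    cases a with
    | β =>
      obtain ⟨w, hw⟩ := ihs hc.1 hc.2.2.1 hs.1
      exact ⟨w ++ (toSym t).leaves, by
        simp only [toSym, leaves, hw, minLabel, min_eq_left hs.2.2.le, List.cons_append]⟩
    | d => cases hr
    | e => cases hr

/-- The least word in the value of a shuffle tree is read off its leaves. -/
theorem hasLeastWord_evalTree {χ : L → Colour} {t : PTree ShGen L}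
    (hc : WellColoured shSignature χ t) (hs : t.IsShuffle) :
    HasLeastWord (evalTree (fun l => word k [l]) (toSym t)) (toSym t).leaves := by
  induction t with
  | leaf l => simp [HasLeastWord, toSym, evalTree, leaves]
  | node a s t ihs iht =>
    have h1 := ihs hc.1 hs.1
    have h2 := iht hc.2.1 hs.2.1
    cases a with
    | β =>
      obtain ⟨w, hw⟩ := leaves_toSym_of_lie hc.1 hc.2.2.1 hs.1
      obtain ⟨v, hv⟩ := leaves_toSym_of_lie hc.2.1 hc.2.2.2 hs.2.1
      rw [hw] at h1
      rw [hv] at h2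
      simp only [toSym, leaves, evalTree, hw, hv]
      exact h1.commutator h2 hs.2.2
    | d => exact h1.mul h2
    | e => exact h2.mul h1

/-! ### Normal trees are determined by their words -/

/-- Along the left spine of a normal bracket the smallest labels of the right branches increase away
from the root. So every label of `s` except the smallest one exceeds the smallest label of `t`. -/
theorem minLabel_lt_of_mem_left {χ : L → Colour} {s t : PTree ShGen L}
    (hn : IsNormal (node .β s t)) (hc : WellColoured shSignature χ (node .β s t)) {q : L}
    (hq : q ∈ s.leaves) : q = s.minLabel ∨ t.minLabel < q := by
  induction s generalizing t with
  | leaf l => exact Or.inl (by simpa [leaves, minLabel] using hq)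
  | node a u v hu hv =>
    cases a with
    | β =>
      have hlt := hn.2.2 _ _ _ rfl
      rcases List.mem_append.1 hq with hq | hq
      · rcases hu hn.1 hc.1 hq with rfl | h
        · by_cases h : u.minLabel ≤ v.minLabel
          · exact Or.inl (min_eq_left h).symm
          · exact Or.inr (hlt.trans (not_le.1 h))
        · exact Or.inr (hlt.trans h)
      · exact Or.inr (hlt.trans_le (minLabel_le _ hq))
    | d => cases hc.2.2.1
    | e => cases hc.2.2.1

theorem length_leaves_toSym {L : Type} (t : PTree ShGen L) :
    (toSym t).leaves.length = t.vertices + 1 := by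
  rw [(leaves_toSym_perm t).length_eq, length_leaves]

theorem minLabel_eq_of_leaves_toSym_eq {s t : PTree ShGen L}
    (h : (toSym s).leaves = (toSym t).leaves) : s.minLabel = t.minLabel := by
  refine minLabel_eq _ ?_ fun l hl => minLabel_le _ ?_
  · rw [← mem_leaves_toSym, h, mem_leaves_toSym]; exact t.minLabel_mem
  · rwa [← mem_leaves_toSym, ← h, mem_leaves_toSym]

/-- A word cannot be cut in two ways. A nonempty overlap `r` begins with the smallest label of `t`.
This label lies in `s'` and is not its smallest one, so by `minLabel_lt_of_mem_left` it exceeds the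
smallest label of `t'`, which lies in `t`: a contradiction. -/
theorem not_append_prefix_of_isNormal {χ : L → Colour} {s t s' t' : PTree ShGen L} {r : List L}
    (hn' : IsNormal (node .β s' t')) (hc : WellColoured shSignature χ (node .β s t))
    (hc' : WellColoured shSignature χ (node .β s' t')) (hs : (node .β s t).IsShuffle)
    (hs' : (node .β s' t').IsShuffle) (h : (toSym s').leaves = (toSym s).leaves ++ r)
    (h' : (toSym t).leaves = r ++ (toSym t').leaves) : r = [] := by
  cases r with
  | nil => rfl
  | cons z r =>
    obtain ⟨w, hw⟩ := leaves_toSym_of_lie hc.1 hc.2.2.1 hs.1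
    obtain ⟨w', hw'⟩ := leaves_toSym_of_lie hc'.1 hc'.2.2.1 hs'.1
    obtain ⟨v, hv⟩ := leaves_toSym_of_lie hc.2.1 hc.2.2.2 hs.2.1
    obtain rfl : t.minLabel = z := by
      rw [hv] at h'; exact (List.cons.inj h').1
    have hm : s'.minLabel = s.minLabel := by
      rw [hw, hw'] at h; exact (List.cons.inj h).1
    have h1 : t.minLabel ∈ s'.leaves := by
      rw [← mem_leaves_toSym, h]; simp
    have h2 : t'.minLabel ∈ t.leaves := by
      rw [← mem_leaves_toSym, h', List.mem_append, mem_leaves_toSym]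
      exact Or.inr t'.minLabel_mem
    rcases minLabel_lt_of_mem_left hn' hc' h1 with h3 | h3
    · exact absurd (h3.trans hm) hs.2.2.ne'
    · exact absurd (minLabel_le _ h2) (not_le.2 h3)

/-- For a bracket the cut between the two branches is forced by normality. For an action the first
letter is the Lie leaf acting at the root, and whether it sits under `d` or `e` is forced by the
shuffle condition. -/
theorem eq_of_leaves_toSym_eq {χ : L → Colour} {t t' : PTree ShGen L} (hn : IsNormal t)
    (hn' : IsNormal t') (hc : WellColoured shSignature χ t) (hc' : WellColoured shSignature χ t')
    (hr : rootColour shSignature χ t = rootColour shSignature χ t') (hs : t.IsShuffle)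
    (hs' : t'.IsShuffle) (h : (toSym t).leaves = (toSym t').leaves) : t = t' := by
  have hlen := congrArg List.length h
  rw [length_leaves_toSym, length_leaves_toSym] at hlen
  induction t generalizing t' with
  | leaf l =>
    cases t' with
    | leaf l' => simpa [toSym, leaves] using h
    | node a' s' u' => simp [vertices] at hlen
  | node a s u ihs ihu =>
    cases t' with
    | leaf l => simp [vertices] at hlen
    | node a' s' u' =>
      have hcons : ∀ {x y : L} {v v' : PTree ShGen L},
          (toSym (leaf x)).leaves ++ (toSym v).leaves =
            (toSym (leaf y)).leaves ++ (toSym v').leaves →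
          x = y ∧ (toSym v).leaves = (toSym v').leaves := fun h => List.cons.inj h
      have hl : ∀ {v v' : PTree ShGen L}, (toSym v).leaves = (toSym v').leaves →
          v.vertices + 1 = v'.vertices + 1 := fun h => by
        rw [← length_leaves_toSym, h, length_leaves_toSym]
      cases a <;> cases a' <;> try (cases hr; done)
      case β.β =>
        have hcolour := hc.2.2.1.trans hc'.2.2.1.symm
        have hcolour' := hc.2.2.2.trans hc'.2.2.2.symm
        have key : (toSym s).leaves = (toSym s').leaves ∧ (toSym u).leaves = (toSym u').leaves := by
          rcases List.append_eq_append_iff.1 h with ⟨r, h1, h2⟩ | ⟨r, h1, h2⟩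
          · obtain rfl := not_append_prefix_of_isNormal hn' hc hc' hs hs' h1 h2
            exact ⟨by simpa using h1.symm, h2⟩
          · obtain rfl := not_append_prefix_of_isNormal hn hc' hc hs' hs h1 h2
            exact ⟨by simpa using h1, h2.symm⟩
        rw [ihs hn.1 hn'.1 hc.1 hc'.1 hcolour hs.1 hs'.1 key.1 (hl key.1),
          ihu hn.2.1 hn'.2.1 hc.2.1 hc'.2.1 hcolour' hs.2.1 hs'.2.1 key.2 (hl key.2)]
      case d.d =>
        obtain ⟨-, n1, x, rfl⟩ := hn
        obtain ⟨-, n1', x', rfl⟩ := hn'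
        obtain ⟨rfl, h'⟩ := hcons h
        rw [ihu n1 n1' hc.2.1 hc'.2.1 (hc.2.2.2.trans hc'.2.2.2.symm) hs.2.1 hs'.2.1 h' (hl h')]
      case e.e =>
        obtain ⟨n1, -, x, rfl⟩ := hn
        obtain ⟨n1', -, x', rfl⟩ := hn'
        obtain ⟨rfl, h'⟩ := hcons h
        rw [ihs n1 n1' hc.1 hc'.1 (hc.2.2.1.trans hc'.2.2.1.symm) hs.1 hs'.1 h' (hl h')]
      case d.e =>
        obtain ⟨-, -, x, rfl⟩ := hn
        obtain ⟨-, -, x', rfl⟩ := hn'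
        obtain ⟨rfl, h'⟩ := hcons h
        -- With the same Lie leaf and the same word for the module branch, `d` requires the leaf to
        -- be below all labels of the branch, whereas `e` requires the smallest label of the branch
        -- to be below the leaf.
        have h1 := hs.2.2
        rw [minLabel_eq_of_leaves_toSym_eq h'] at h1
        exact absurd h1 hs'.2.2.asymm
      case e.d =>
        obtain ⟨-, -, x, rfl⟩ := hn
        obtain ⟨-, -, x', rfl⟩ := hn'
        obtain ⟨rfl, h'⟩ := hcons h
        have h1 := hs.2.2
        rw [minLabel_eq_of_leaves_toSym_eq h'] at h1
        exact absurd h1 hs'.2.2.asymm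

end Words

/-! ### The Gröbner basis -/

section Groebner

variable {k : Type*} [Field k] {n : ℕ} {χ : Fin n → Colour} {c : Colour}

/-- The normal trees are linearly independent modulo the relations. -/
theorem eq_zero_of_isNormal {y : PTree ShGen (Fin n) →₀ k} (hy : y ∈ MLieIdeal k n χ c)
    (hn : ∀ t ∈ y.support, IsNormal t) : y = 0 := by
  by_contra hne
  -- `t` is chosen with the least word in the support. That word then occurs in the value of no
  -- other tree of the support, so its coefficient in the evaluation of `y` is `y t`, which would
  -- have to vanish.
  obtain ⟨t, ht, hmin⟩ := Finset.exists_min_image y.support (fun t => (toSym t).leaves)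
    (Finsupp.support_nonempty_iff.2 hne)
  obtain ⟨hS, hI⟩ := hy
  have hS : ∀ s ∈ y.support, IsShuffleTree shSignature χ c s := fun s hs => hS hs
  have h0 := linearCombination_evalTree_eq_zero hI fun l => word k [l]
  rw [Finsupp.linearCombination_mapDomain, Finsupp.linearCombination_apply, Finsupp.sum] at h0
  have h1 := congrArg (fun p => p.coeff (FreeMonoid.ofList (toSym t).leaves)) h0
  simp only [MonoidAlgebra.coeff_sum, Finsupp.finsetSum_apply, MonoidAlgebra.coeff_smul_apply,
    Function.comp, MonoidAlgebra.coeff_zero, Finsupp.zero_apply] at h1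
  have hl := fun s hs =>
    hasLeastWord_evalTree (k := k) (hS s hs).1.1 (hS s hs).2
  rw [Finset.sum_eq_single_of_mem t ht] at h1
  · have := coeff_eq_zero_of_mem_wordSpan (hl t ht) (w := (toSym t).leaves)
      fun h => lt_irrefl _ h.2
    rw [MonoidAlgebra.coeff_sub, Finsupp.sub_apply, sub_eq_zero] at this
    rw [this, word, MonoidAlgebra.coeff_single] at h1
    simp at h1
    exact Finsupp.mem_support_iff.1 ht h1
  · intro s hs hst
    rw [coeff_eq_zero_of_mem_wordSpan (hl s hs).mem_wordSpan, smul_zero]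
    rintro ⟨-, hle⟩
    refine hst (eq_of_leaves_toSym_eq (hn s hs) (hn t ht) (hS s hs).1.1 (hS t ht).1.1
      ((hS s hs).1.2.1.trans (hS t ht).1.2.1.symm) (hS s hs).2 (hS t ht).2 ?_)
    exact le_antisymm hle (hmin s hs)

/-! ### Termination of the reduction and normal forms. -/

theorem finite_setOf_vertices_le {Υ L : Type} [Finite Υ] [Finite L] (m : ℕ) :
    {t : PTree Υ L | t.vertices ≤ m}.Finite := by
  induction m with
  | zero =>
    refine (Set.finite_range (leaf : L → PTree Υ L)).subset fun t ht => ?_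
    cases t with
    | leaf l => exact ⟨l, rfl⟩
    | node a s t => simp [vertices] at ht
  | succ m ih =>
    refine ((Set.finite_range (leaf : L → PTree Υ L)).union
      ((Set.finite_univ.prod (ih.prod ih)).image
        fun p : Υ × PTree Υ L × PTree Υ L => node p.1 p.2.1 p.2.2)).subset fun t ht => ?_
    cases t with
    | leaf l => exact Or.inl ⟨l, rfl⟩
    | node a s t =>
      simp only [vertices, Set.mem_ofPred_eq] at ht
      refine Or.inr ⟨(a, s, t), ⟨Set.mem_univ _, ?_, ?_⟩, rfl⟩
      · show s.vertices ≤ m; omega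
      · show t.vertices ≤ m; omega

instance : Finite ShGen :=
  Finite.of_surjective (![.β, .d, .e] : Fin 3 → ShGen) fun a => by
    cases a
    exacts [⟨0, rfl⟩, ⟨1, rfl⟩, ⟨2, rfl⟩]

/-- Finiteness makes the strict path comparison well founded on a component, so no well-ordering of
all tree monomials is needed. -/
theorem finite_setOf_isShuffleTree (χ : Fin n → Colour) (c : Colour) :
    {t | IsShuffleTree shSignature χ c t}.Finite := by
  refine (finite_setOf_vertices_le n).subset fun t ht => ?_
  have h := ht.1.2.2.1.length_le_card
  rw [length_leaves, Fintype.card_fin] at h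
  exact (Nat.le_succ _).trans h

/-- Every tree is, modulo the quadratic relations, a combination of normal trees that are not
greater. -/
theorem exists_normal_form (k : Type*) [Field k] {t : PTree ShGen (Fin n)}
    (ht : IsShuffleTree shSignature χ c t) :
    ∃ y : PTree ShGen (Fin n) →₀ k,
      (∀ u ∈ y.support, IsShuffleTree shSignature χ c u ∧ IsNormal u ∧
        (u = t ∨ PathLT Finset.univ u t)) ∧
      InShuffleIdeal shSignature (relators k) χ c (.single t 1 - y) ∧
      (IsNormal t → y = .single t 1) := by
  classical
  let F : PTree ShGen (Fin n) → List QMonomial := fun t =>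
    List.ofFn fun l => pathMonomial mlieWeight l t
  -- The induction uses the path vectors alone and never a chosen admissible ordering, so the normal
  -- form serves all of them.
  have hwf : {t | IsShuffleTree shSignature χ c t}.WellFoundedOn (F ⁻¹'o (· < ·)) :=
    (finite_setOf_isShuffleTree χ c).wellFoundedOn
  apply hwf.induction ht
  intro t ht ih
  by_cases hn : IsNormal t
  · refine ⟨.single t 1, fun u hu => ?_, ?_, fun _ => rfl⟩
    · obtain rfl := Finset.mem_singleton.1 (Finsupp.support_single_subset hu)
      exact ⟨ht, hn, Or.inl rfl⟩
    · rw [sub_self]; exact .zero _ _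
  · obtain ⟨y, hy, hI⟩ := reducible_of_not_isNormal (k := k) (isShuffleTree_iff.1 ht) hn
    rw [idealOn_univ_iff] at hI
    choose! z hz1 hz2 hz3 using fun u (hu : u ∈ y.support) =>
      ih u (isShuffleTree_iff.2 (hy u hu).1) (pathLT_univ_iff.1 (hy u hu).2)
    refine ⟨y.sum fun u b => b • z u, fun v hv => ?_, ?_, fun h => absurd h hn⟩
    · obtain ⟨u, hu, hv⟩ := Finset.mem_biUnion.1 (Finsupp.support_sum hv)
      obtain ⟨h1, h2, h3⟩ := hz1 u hu v (Finsupp.support_smul hv)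
      refine ⟨h1, h2, Or.inr ?_⟩
      rcases h3 with rfl | h3
      · exact (hy v hu).2
      · exact h3.trans (hy u hu).2
    · have h1 : InShuffleIdeal shSignature (relators k) χ c
          (∑ u ∈ y.support, y u • (Finsupp.single u 1 - z u)) := by
        refine Finset.sum_induction _ (InShuffleIdeal shSignature (relators k) χ c)
          (fun _ _ => .add) (.zero _ _) fun u hu => (hz2 u hu).smul _
      have h2 : y = ∑ u ∈ y.support, y u • Finsupp.single u (1 : k) := by
        conv_lhs => rw [← Finsupp.sum_single y]
        simp [Finsupp.sum]
      convert hI.add h1 using 1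
      simp only [smul_sub, Finset.sum_sub_distrib, ← h2, Finsupp.sum]
      abel

/-- Every element is congruent modulo the quadratic relations to a combination of normal trees, in
which a maximal normal tree keeps its coefficient. -/
theorem exists_normal_combination {x : PTree ShGen (Fin n) →₀ k}
    (hx : x ∈ freeShuffle k shSignature χ c) :
    ∃ y : PTree ShGen (Fin n) →₀ k, (∀ u ∈ y.support, IsNormal u) ∧
      InShuffleIdeal shSignature (relators k) χ c (x - y) ∧
      ∀ t ∈ x.support, IsNormal t → (∀ s ∈ x.support, ¬ PathLT Finset.univ t s) → y t = x t := by
  classical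
  choose! z hz1 hz2 hz3 using fun u (hu : u ∈ x.support) =>
    exists_normal_form k (t := u) (hx hu)
  refine ⟨x.sum fun u b => b • z u, fun v hv => ?_, ?_, fun t ht hn hmax => ?_⟩
  · obtain ⟨u, hu, hv⟩ := Finset.mem_biUnion.1 (Finsupp.support_sum hv)
    exact (hz1 u hu v (Finsupp.support_smul hv)).2.1
  · have h1 : InShuffleIdeal shSignature (relators k) χ c
        (∑ u ∈ x.support, x u • (Finsupp.single u 1 - z u)) := by
      refine Finset.sum_induction _ (InShuffleIdeal shSignature (relators k) χ c)
        (fun _ _ => .add) (.zero _ _) fun u hu => (hz2 u hu).smul _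
    have h2 : x = ∑ u ∈ x.support, x u • Finsupp.single u (1 : k) := by
      conv_lhs => rw [← Finsupp.sum_single x]
      simp [Finsupp.sum]
    convert h1 using 1
    simp only [smul_sub, Finset.sum_sub_distrib, ← h2, Finsupp.sum]
  · rw [Finsupp.sum, Finsupp.finsetSum_apply, Finset.sum_eq_single_of_mem t ht]
    · simp [hz3 t ht hn]
    · intro s hs hst
      rw [Finsupp.smul_apply]
      by_contra h
      have : t ∈ (z s).support := by
        rw [Finsupp.mem_support_iff]
        rintro h'
        exact h (by rw [h', smul_zero])
      rcases (hz1 s hs t this).2.2 with rfl | h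
      · exact hst rfl
      · exact hmax s hs h

/-- Since x and x − y are both relations of MLie, so is the normal combination `y`, and normal trees
are independent. -/
theorem eq_zero_of_mem_mlieIdeal {x : PTree ShGen (Fin n) →₀ k}
    (hx : x ∈ MLieIdeal k n χ c) {y : PTree ShGen (Fin n) →₀ k} (hn : ∀ u ∈ y.support, IsNormal u)
    (hy : InShuffleIdeal shSignature (relators k) χ c (x - y)) : y = 0 := by
  have h := mem_mlieIdeal_of_inShuffleIdeal hy
  refine eq_zero_of_isNormal (χ := χ) (c := c) ⟨?_, ?_⟩ hn
  · have := sub_mem hx.1 h.1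
    rwa [sub_sub_cancel] at this
  · have := hx.2.add (h.2.smul (-1))
    rwa [← Finsupp.mapDomain_smul, ← Finsupp.mapDomain_add, neg_one_smul, ← sub_eq_add_neg,
      sub_sub_cancel] at this

theorem isGroebnerBasis_relators (k : Type*) [Field k]
    {r : TreeMonomial shSignature → TreeMonomial shSignature → Prop}
    (hr : IsAdmissible shSignature r) (hq : ExtendsQM mlieWeight r) :
    IsGroebnerBasis shSignature r (relators k) (MLieIdeal k) where
  generates n χ c x := by
    refine ⟨fun hx => ?_, mem_mlieIdeal_of_inShuffleIdeal⟩
    obtain ⟨y, hn, hy, -⟩ := exists_normal_combination hx.1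
    rw [eq_zero_of_mem_mlieIdeal hx hn hy, sub_zero] at hy
    exact hy
  divisible n χ c x hx t ht := by
    obtain ⟨ht1, ht2, ht3⟩ := ht
    have hnt : ¬ IsNormal t := by
      intro hnt
      obtain ⟨y, hn, hy, hmax⟩ := exists_normal_combination hx.1
      rw [eq_zero_of_mem_mlieIdeal hx hn hy] at hmax
      refine Finsupp.mem_support_iff.1 ht1 (hmax t ht1 hnt fun s hs hlt => ?_).symm
      obtain ⟨hs', hle⟩ := ht3 s hs
      -- A term `s` above `t` in the QM-ordering is above `t` for `r` as well, while `t` is the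
      -- leading term. Antisymmetry would give `s = t`, so `t` is QM-maximal in the support of `x`.
      have := hr.antisymm _ _ hle (hq _ _ (hlt.qmLt ht2 hs'))
      injection this with _ _ _ h
      exact hlt.ne h.symm
    obtain ⟨ρ, φ, hb, hm, hc⟩ := exists_isBranch_of_not_isNormal (isShuffleTree_iff.1 ht2) hnt
    refine ⟨3, ρ.colouring, ρ.colour, _, ⟨ρ⟩, ρ.lead, ρ.isLeadingTerm_lead hr hq, φ, hb, hm, hc, ?_⟩
    rw [rootColour_bind (χ' := ρ.colouring) _ _ fun l _ => hc l, ρ.isShuffleTree_lead.1.2.1]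

end Groebner

end ColouredOperad

end

theorem mainTheorem7 (k : Type*) [Field k] [CharZero k] :
    (∃ r : ColouredOperad.TreeMonomial ColouredOperad.shSignature →
        ColouredOperad.TreeMonomial ColouredOperad.shSignature → Prop,
      ColouredOperad.IsAdmissible ColouredOperad.shSignature r ∧
        ColouredOperad.ExtendsQM ColouredOperad.mlieWeight r) ∧
    ∃ G : ColouredOperad.Family k ColouredOperad.Colour ColouredOperad.ShGen,
      ColouredOperad.IsQuadratic G ∧
      ∀ r : ColouredOperad.TreeMonomial ColouredOperad.shSignature →
          ColouredOperad.TreeMonomial ColouredOperad.shSignature → Prop,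
        ColouredOperad.IsAdmissible ColouredOperad.shSignature r →
        ColouredOperad.ExtendsQM ColouredOperad.mlieWeight r →
        ColouredOperad.IsGroebnerBasis ColouredOperad.shSignature r G
          (ColouredOperad.MLieIdeal k) :=
  ⟨⟨_, ColouredOperad.isAdmissible_sortKey _, ColouredOperad.extendsQM_sortKey _⟩,
    ColouredOperad.relators k, ColouredOperad.isQuadratic_relators k,
    fun _ hr hq => ColouredOperad.isGroebnerBasis_relators k hr hq⟩
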